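/- **Setting.** Let $1\le r\le n$, let $\mathbf Z^*\in\mathbb R^{n\times r}$ have rank $r$, $\mathbf X^*=\mathbf Z^*\mathbf Z^{*\top}$, $\sigma_{\min}=\sigma_r(\mathbf X^*)/n$ and $\kappa=\sigma_1(\mathbf X^*)/\sigma_r(\mathbf X^*)$, where $\sigma_k$ is the $k$-th largest singular value. $\|\cdot\|_F$, $\|\cdot\|$ and $\|\cdot\|_{2\to\infty}$ denote the Frobenius norm, the operator norm and the largest Euclidean norm of a row. For $\mathbf Z\in\mathbb R^{n\times r}$ let $\mathbf R^*\in\arg\min_{\mathbf R\mathbf R^\top=\mathbf I_r}\|\mathbf Z\mathbf R-\mathbf Z^*\|_F$ (any fixed choice if it is not unique), and $$\mathrm{dist}_2(\mathbf Z,\mathbf Z^*)=\|\mathbf Z\mathbf R^*-\mathbf Z^*\|_F,\qquad \mathrm{dist}_\infty(\mathbf Z,\mathbf Z^*)=\|\mathbf Z\mathbf R^*-\mathbf Z^*\|_{2\to\infty}.$$ For $\epsilon>0$ let $\mathcal D^{(2)}(\epsilon)=\{\mathbf Z:\mathrm{dist}_2(\mathbf Z,\mathbf Z^*)\le\epsilon\|\mathbf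 Z^*\|_F\}$ and $\mathcal D^{(\infty)}(\epsilon)=\{\mathbf Z\in\mathcal D^{(2)}(\epsilon):\mathrm{dist}_\infty(\mathbf Z,\mathbf Z^*)\le\epsilon\|\mathbf Z^*\|_{2\to\infty}\}$. Let $\mathcal L:\mathbb R^{n\times n}\to\mathbb R$ be twice continuously differentiable near every $\mathbf Z\mathbf Z^\top$ with $\mathbf Z$ in the local region $\mathcal D$ under consideration, put $\mathcal G(\mathbf Z)=\nabla_{\mathbf X}\mathcal L(\mathbf Z\mathbf Z^\top)$ and $\mathcal P_{\mathbf Z}(\mathbf W)=\mathbf Z\mathbf W^\top+\mathbf W\mathbf Z^\top$, and assume $\mathcal G(\mathbf Z^*)=\mathbf 0$ (noiseless case). For a region $\mathcal D$ consider the conditions: * (A1) $\beta\ge\alpha>0$ and $\alpha\|\mathcal P_{\mathbf Z}(\mathbf W)\|_F^2\le\nabla^2_{\mathbf X}\mathcal L(\mathbf Z\mathbf Z^\top)[\mathcal P_{\mathbf Z}(\mathbf W),\mathcal P_{\mathbf Z}(\mathbf W)]\le\beta\|\mathcal P_{\mathbf Z}(\mathbf W)\|_F^2$ for all $\mathbf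 Z\in\mathcal D$ and $\mathbf W\in\mathbb R^{n\times r}$; * (A2) $\|\mathcal G(\mathbf Z_1)-\mathcal G(\mathbf Z_2)\|\le L_2\|\mathbf Z_1\mathbf Z_1^\top-\mathbf Z_2\mathbf Z_2^\top\|_F$ for all $\mathbf Z_1,\mathbf Z_2\in\mathcal D$; * (A3) $|\nabla^2_{\mathbf X}\mathcal L(\mathbf Z\mathbf Z^\top)[\mathcal P_{\mathbf Z}(\mathbf e_i\mathbf h^\top),\mathcal P_{\mathbf Z}(\mathbf W)]|\le\beta\,\|\mathbf Z_{i,\cdot}\|\,\|\mathbf h\|\,\|\mathbf Z\|\,\|\mathbf W\|_F$ for all $\mathbf Z\in\mathcal D$, $i\in[n]$, $\mathbf h\in\mathbb R^r$ and $\mathbf W\in\mathbb R^{n\times r}$ with $\mathbf W_{i,\cdot}=\mathbf 0$; * (A4) $\|\mathcal G(\mathbf Z_1)-\mathcal G(\mathbf Z_2)\|_{2\to\infty}\le L_\infty\|\mathbf Z_1\mathbf Z_1^\top-\mathbf Z_2\mathbf Z_2^\top\|_{2\to\infty}$ for all $\mathbf Z_1,\mathbf Z_2\in\mathcal D$. Let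 $\mathbf Z^{t+1}=\mathbf Z^t-n^{-1}\eta\,\nabla_{\mathbf Z}\mathcal L(\mathbf Z^t\mathbf Z^{t\top})$ for $t\ge0$, with $\eta=\{10(\alpha+\beta)\kappa\sigma_{\min}\}^{-1}$, and let $\rho=1-\eta\alpha\sigma_{\min}/4$. **Theorem ($\ell_2$-error contraction).** For every $L_2$ there is a constant $c_0>0$, depending only on $L_2$, such that the following holds. Suppose (A1) and (A2) hold with $\mathcal D=\mathcal D^{(2)}(\epsilon)$, and $$\mathrm{dist}_2(\mathbf Z^0,\mathbf Z^*)\le\phi_n\|\mathbf Z^*\|_F\quad\text{with}\quad \phi_n\le\tfrac{\epsilon}{2}\wedge c_0\tfrac{\alpha}{\kappa\sqrt r}.\tag{1}$$ Then for all $t$, $$\mathrm{dist}_2(\mathbf Z^t,\mathbf Z^*)\le\rho^t\phi_n\|\mathbf Z^*\|_F.\tag{2}$$ **($\ell_\infty$-error contraction).** For all $L_2,L_\infty,\bar\epsilon$ there is a constant $c_0>0$, depending only on $L_2,L_\infty,\bar\epsilon$, such that the following holds whenever $\epsilon\le\bar\epsilon$. Suppose (A1)–(A4) hold with $\mathcal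 D=\mathcal D^{(\infty)}(\epsilon)$ and $\mathcal G(\mathbf Z)$ is symmetric for $\mathbf Z\in\mathcal D$ (so that $\nabla_{\mathbf Z}\mathcal L(\mathbf Z\mathbf Z^\top)=2\mathcal G(\mathbf Z)\mathbf Z$). If (1) holds and $$\mathrm{dist}_\infty(\mathbf Z^0,\mathbf Z^*)\le\psi_n\|\mathbf Z^*\|_{2\to\infty}\quad\text{with}\quad 0<\psi_n\le\tfrac{\epsilon}{2}\ \text{ and }\ \tfrac{\beta}{\alpha}\kappa^{3/2}\sqrt r\,\tfrac{\phi_n}{\psi_n}\le c_0,$$ then for all $t$, (2) holds and $$\mathrm{dist}_\infty(\mathbf Z^t,\mathbf Z^*)\le\rho^t\psi_n\|\mathbf Z^*\|_{2\to\infty}.$$ -/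

import Mathlib

open scoped Matrix Matrix.Norms.Frobenius

/- Throughout, `‖M‖` is the Frobenius norm of a real matrix `M`. -/

/-- The operator (spectral) norm of a real matrix. -/
noncomputable def opNorm {n m : ℕ} (M : Matrix (Fin n) (Fin m) ℝ) : ℝ :=
  ‖(Matrix.toEuclideanLin M).toContinuousLinearMap‖

/-- The two-to-infinity norm: the largest Euclidean norm of a row. -/
noncomputable def twoInfNorm {n m : ℕ} (M : Matrix (Fin n) (Fin m) ℝ) : ℝ :=
  ⨆ i : Fin n, ‖WithLp.toLp 2 (M i)‖

/-- The `k`-th largest singular value `σ_k(M)`, for `k ≥ 1`. -/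
noncomputable def sigma {n m : ℕ} (k : ℕ) (M : Matrix (Fin n) (Fin m) ℝ) : ℝ :=
  (Matrix.toEuclideanLin M).singularValues (k - 1)

/-- `R` solves the orthogonal Procrustes problem of aligning `Z` with `Zs`. -/
def IsProcrustes {n r : ℕ} (Z Zs : Matrix (Fin n) (Fin r) ℝ) (R : Matrix (Fin r) (Fin r) ℝ) :
    Prop :=
  R * Rᵀ = 1 ∧ ∀ Q : Matrix (Fin r) (Fin r) ℝ, Q * Qᵀ = 1 → ‖Z * R - Zs‖ ≤ ‖Z * Q - Zs‖

theorem exists_isProcrustes {n r : ℕ} (Z Zs : Matrix (Fin n) (Fin r) ℝ) :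
    ∃ R, IsProcrustes Z Zs R := by
  have hcl : IsClosed {R : Matrix (Fin r) (Fin r) ℝ | R * Rᵀ = 1} :=
    isClosed_eq (by fun_prop) continuous_const
  have hbd : Bornology.IsBounded {R : Matrix (Fin r) (Fin r) ℝ | R * Rᵀ = 1} := by
    refine (isBounded_iff_forall_norm_le).2 ⟨(∑ _i : Fin r, ∑ _j : Fin r, (1 : ℝ) ^ (2 : ℝ)) ^
      (1 / 2 : ℝ), fun R hR => ?_⟩
    have hU : R ∈ Matrix.unitaryGroup (Fin r) ℝ := by
      rw [Matrix.mem_unitaryGroup_iff]; exact hR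
    rw [Matrix.frobenius_norm_def]
    gcongr with i _ j _
    exact entry_norm_bound_of_unitary hU i j
  have : ProperSpace (Matrix (Fin r) (Fin r) ℝ) := FiniteDimensional.proper ℝ _
  have hco : IsCompact {R : Matrix (Fin r) (Fin r) ℝ | R * Rᵀ = 1} :=
    Metric.isCompact_of_isClosed_isBounded hcl hbd
  obtain ⟨R, hR, hmin⟩ := hco.exists_isMinOn (f := fun R => ‖Z * R - Zs‖) ⟨1, by simp⟩
    (by fun_prop)
  exact ⟨R, hR, fun Q hQ => hmin hQ⟩

/-- An optimal alignment `R^*` of `Z` with `Zs` (a fixed, arbitrary choice if it is not unique). -/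
noncomputable def procrustes {n r : ℕ} (Z Zs : Matrix (Fin n) (Fin r) ℝ) :
    Matrix (Fin r) (Fin r) ℝ :=
  (exists_isProcrustes Z Zs).choose

theorem procrustes_spec {n r : ℕ} (Z Zs : Matrix (Fin n) (Fin r) ℝ) :
    IsProcrustes Z Zs (procrustes Z Zs) :=
  (exists_isProcrustes Z Zs).choose_spec

/-- `dist_2(Z, Zs)`. -/
noncomputable def distTwo {n r : ℕ} (Z Zs : Matrix (Fin n) (Fin r) ℝ) : ℝ :=
  ‖Z * procrustes Z Zs - Zs‖

/-- `dist_∞(Z, Zs)`. -/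
noncomputable def distInf {n r : ℕ} (Z Zs : Matrix (Fin n) (Fin r) ℝ) : ℝ :=
  twoInfNorm (Z * procrustes Z Zs - Zs)

/-- The local region defined by the `ℓ₂` distance. -/
def regionTwo {n r : ℕ} (Zs : Matrix (Fin n) (Fin r) ℝ) (ε : ℝ) :
    Set (Matrix (Fin n) (Fin r) ℝ) :=
  {Z | distTwo Z Zs / ‖Zs‖ ≤ ε}

/-- The local region defined by both the `ℓ₂` and the `ℓ_∞` distance. -/
def regionInf {n r : ℕ} (Zs : Matrix (Fin n) (Fin r) ℝ) (ε : ℝ) :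
    Set (Matrix (Fin n) (Fin r) ℝ) :=
  {Z | distTwo Z Zs / ‖Zs‖ ≤ ε ∧ distInf Z Zs / twoInfNorm Zs ≤ ε}

/-- The gradient of a function of a matrix, as the matrix of its partial derivatives. -/
noncomputable def matGrad {n m : ℕ} (f : Matrix (Fin n) (Fin m) ℝ → ℝ)
    (X : Matrix (Fin n) (Fin m) ℝ) : Matrix (Fin n) (Fin m) ℝ :=
  Matrix.of fun i j => fderiv ℝ f X (Matrix.single i j 1)

/-- The Hessian bilinear form `∇² f(X)[A, B]`. -/
noncomputable def matHess {n m : ℕ} (f : Matrix (Fin n) (Fin m) ℝ → ℝ)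
    (X A B : Matrix (Fin n) (Fin m) ℝ) : ℝ :=
  fderiv ℝ (fderiv ℝ f) X A B

/-- `𝒢(Z) = ∇_X L(Z Zᵀ)`. -/
noncomputable def gradAt {n r : ℕ} (L : Matrix (Fin n) (Fin n) ℝ → ℝ)
    (Z : Matrix (Fin n) (Fin r) ℝ) : Matrix (Fin n) (Fin n) ℝ :=
  matGrad L (Z * Zᵀ)

/-- The tangent direction `𝒫_Z(W) = Z Wᵀ + W Zᵀ`. -/
def tangent {n r : ℕ} (Z W : Matrix (Fin n) (Fin r) ℝ) : Matrix (Fin n) (Fin n) ℝ :=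
  Z * Wᵀ + W * Zᵀ

/-- The loss is twice continuously differentiable near every `Z Zᵀ` with `Z ∈ D`. -/
def SmoothOnRegion {n r : ℕ} (L : Matrix (Fin n) (Fin n) ℝ → ℝ)
    (D : Set (Matrix (Fin n) (Fin r) ℝ)) : Prop :=
  ∀ Z ∈ D, ContDiffAt ℝ 2 L (Z * Zᵀ)

/-- Local restricted isometry property on `D`, with constants `β ≥ α > 0`. -/
def LocalRIP {n r : ℕ} (L : Matrix (Fin n) (Fin n) ℝ → ℝ)
    (D : Set (Matrix (Fin n) (Fin r) ℝ)) (α β : ℝ) : Prop :=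
  0 < α ∧ α ≤ β ∧ ∀ Z ∈ D, ∀ W : Matrix (Fin n) (Fin r) ℝ,
    α * ‖tangent Z W‖ ^ 2 ≤ matHess L (Z * Zᵀ) (tangent Z W) (tangent Z W) ∧
      matHess L (Z * Zᵀ) (tangent Z W) (tangent Z W) ≤ β * ‖tangent Z W‖ ^ 2

/-- Local Lipschitz condition for `𝒢` in operator norm. -/
def LocalGradLipschitz {n r : ℕ} (L : Matrix (Fin n) (Fin n) ℝ → ℝ)
    (D : Set (Matrix (Fin n) (Fin r) ℝ)) (L₂ : ℝ) : Prop :=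
  ∀ Z₁ ∈ D, ∀ Z₂ ∈ D,
    opNorm (gradAt L Z₁ - gradAt L Z₂) ≤ L₂ * ‖Z₁ * Z₁ᵀ - Z₂ * Z₂ᵀ‖

/-- Row-wise control of the Hessian on `D`. Here `Matrix.vecMulVec (Pi.single i 1) h` is the matrix
`e_i hᵀ`, whose `i`-th row is `h` and whose other rows vanish. -/
def RowHessianBound {n r : ℕ} (L : Matrix (Fin n) (Fin n) ℝ → ℝ)
    (D : Set (Matrix (Fin n) (Fin r) ℝ)) (β : ℝ) : Prop :=
  ∀ Z ∈ D, ∀ (i : Fin n) (h : Fin r → ℝ) (W : Matrix (Fin n) (Fin r) ℝ), W i = 0 →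
    |matHess L (Z * Zᵀ) (tangent Z (Matrix.vecMulVec (Pi.single i 1) h)) (tangent Z W)| ≤
      β * (‖WithLp.toLp 2 (Z i)‖ * ‖WithLp.toLp 2 h‖) * (opNorm Z * ‖W‖)

/-- Local Lipschitz condition for `𝒢` in the two-to-infinity norm. -/
def RowGradLipschitz {n r : ℕ} (L : Matrix (Fin n) (Fin n) ℝ → ℝ)
    (D : Set (Matrix (Fin n) (Fin r) ℝ)) (Linf : ℝ) : Prop :=
  ∀ Z₁ ∈ D, ∀ Z₂ ∈ D,
    twoInfNorm (gradAt L Z₁ - gradAt L Z₂) ≤ Linf * twoInfNorm (Z₁ * Z₁ᵀ - Z₂ * Z₂ᵀ)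

/-- `σ_min = σ_r(Zs Zsᵀ) / n`. -/
noncomputable def sigmaMin {n r : ℕ} (Zs : Matrix (Fin n) (Fin r) ℝ) : ℝ :=
  sigma r (Zs * Zsᵀ) / n

/-- `κ = σ_1(Zs Zsᵀ) / σ_r(Zs Zsᵀ)`. -/
noncomputable def condNumber {n r : ℕ} (Zs : Matrix (Fin n) (Fin r) ℝ) : ℝ :=
  sigma 1 (Zs * Zsᵀ) / sigma r (Zs * Zsᵀ)

/-- The step size `η = {10 (α + β) κ σ_min}⁻¹`. -/
noncomputable def stepSize {n r : ℕ} (Zs : Matrix (Fin n) (Fin r) ℝ) (α β : ℝ) : ℝ :=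
  (10 * (α + β) * condNumber Zs * sigmaMin Zs)⁻¹

/-- The contraction factor `ρ = 1 - η α σ_min / 4`. -/
noncomputable def rate {n r : ℕ} (Zs : Matrix (Fin n) (Fin r) ℝ) (α β : ℝ) : ℝ :=
  1 - stepSize Zs α β * α * sigmaMin Zs / 4

/-- `Z` is a gradient descent trajectory for `Z ↦ L (Z Zᵀ)` with step size `η / n`. -/
def IsGradientDescent {n r : ℕ} (L : Matrix (Fin n) (Fin n) ℝ → ℝ) (η : ℝ)
    (Z : ℕ → Matrix (Fin n) (Fin r) ℝ) : Prop :=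
  ∀ t, Z (t + 1) = Z t - ((n : ℝ)⁻¹ * η) • matGrad (fun Y => L (Y * Yᵀ)) (Z t)

/-! Write `Δ = Z * R - Zs` with `R` the Procrustes rotation, `γ = η / n`, and `sr`, `s₁` for the
square roots of the `r`-th and first singular values of `Zs * Zsᵀ`; then `γ (α + β) s₁² = 1/10`.
Since the gradient in `X` vanishes at `Zs`, the mean value theorem along the segment from `Zs` to
`Zs + Δ` expresses the factored gradient, tested on any direction `V`, as the Hessian form at some
`Y` on the segment applied to `tangent Y Δ` and `tangent Y V`, plus `frob (gradAt L Y) (tangent Δ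
V)`, which is of second order in `Δ` (`exists_frob_gradAt_tangent_eq`).

Frobenius norm. First-order optimality of `R` makes `Zsᵀ * Δ` symmetric
(`IsProcrustes.transpose_mul_comm`). This excludes the rotational directions in which `tangent`
degenerates, so (A1) gives curvature of order `α sr²` along `Δ`, and one step multiplies `‖Δ‖²` by
at most `1 - γ α sr²` (`norm_sub_smul_sq_le`). The old rotation competes in the next Procrustes
problem, so `distTwo` contracts as well. The constant may depend on `L₂` only, yet the radius in (1)
carries a factor `α`; the bound `α ≤ 5 Λ` (`LocalRIP.le_of_localGradLipschitz`) makes that radius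
small relative to `sr`.

Row norm. Testing the same identity on a single row splits the Hessian term into the action of the
row on itself, which contracts by (A1), and the influence of the other rows, small by (A3) because
`‖Δ‖` is small compared with the row error; (A4) controls the remainder (`l2_row_sub_smul_le`). The
Procrustes rotation does not minimise the row norm, so the change of alignment must be estimated:
the asymmetry of `Zsᵀ * (Zs + Δ - γ • W)`, with `W` the aligned gradient, comes only from `Zsᵀ * G *
Δ`, where `G` is `gradAt L (Zs + Δ)`, so the extra rotation is quadratically small
(`mul_norm_sub_one_le`). Both errors are bounded with the same rate `ρ`, so the ratio `φ / ψ` of the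
bounds persists along the iteration. -/

/-- The Euclidean norm of a vector of coordinates. -/
noncomputable abbrev l2 {m : ℕ} (v : Fin m → ℝ) : ℝ := ‖WithLp.toLp 2 v‖

/-- The Frobenius inner product. -/
def frob {n m : ℕ} (A B : Matrix (Fin n) (Fin m) ℝ) : ℝ := (Aᵀ * B).trace

/-! ### Frobenius inner product. -/

section Frob
variable {n m k : ℕ}

theorem frob_eq_sum (A B : Matrix (Fin n) (Fin m) ℝ) :
    frob A B = ∑ i, A i ⬝ᵥ B i := by
  simp only [frob, Matrix.trace, Matrix.diag_apply, Matrix.mul_apply, Matrix.transpose_apply,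
    dotProduct]
  exact Finset.sum_comm

theorem frob_comm (A B : Matrix (Fin n) (Fin m) ℝ) : frob A B = frob B A := by
  simp only [frob_eq_sum, dotProduct_comm]

theorem frob_add_right (A B C : Matrix (Fin n) (Fin m) ℝ) :
    frob A (B + C) = frob A B + frob A C := by
  simp [frob, Matrix.mul_add]

theorem frob_sub_right (A B C : Matrix (Fin n) (Fin m) ℝ) :
    frob A (B - C) = frob A B - frob A C := by
  simp [frob, Matrix.mul_sub]

theorem frob_smul_right (c : ℝ) (A B : Matrix (Fin n) (Fin m) ℝ) :
    frob A (c • B) = c * frob A B := by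
  simp [frob]

theorem frob_add_left (A B C : Matrix (Fin n) (Fin m) ℝ) :
    frob (A + B) C = frob A C + frob B C := by
  simp [frob, Matrix.add_mul]

theorem frob_sub_left (A B C : Matrix (Fin n) (Fin m) ℝ) :
    frob (A - B) C = frob A C - frob B C := by
  simp [frob, Matrix.sub_mul]

theorem frob_smul_left (c : ℝ) (A B : Matrix (Fin n) (Fin m) ℝ) :
    frob (c • A) B = c * frob A B := by
  simp [frob]

theorem frob_mul_eq_left (A : Matrix (Fin n) (Fin k) ℝ) (B : Matrix (Fin k) (Fin m) ℝ)
    (C : Matrix (Fin n) (Fin m) ℝ) : frob (A * B) C = frob B (Aᵀ * C) := by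
  simp [frob, Matrix.mul_assoc]

theorem frob_mul_eq_right (A : Matrix (Fin n) (Fin k) ℝ) (B : Matrix (Fin k) (Fin m) ℝ)
    (C : Matrix (Fin n) (Fin m) ℝ) : frob (A * B) C = frob A (C * Bᵀ) := by
  rw [frob, frob, Matrix.transpose_mul, Matrix.mul_assoc, Matrix.trace_mul_comm, Matrix.mul_assoc]

theorem frob_transpose (A B : Matrix (Fin n) (Fin m) ℝ) : frob Aᵀ Bᵀ = frob A B := by
  rw [frob_comm A, frob, frob, Matrix.transpose_transpose, Matrix.trace_mul_comm]

theorem frob_eq_zero_of_forall {A : Matrix (Fin n) (Fin m) ℝ} (h : ∀ B, frob A B = 0) : A = 0 := by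
  have := h A
  rw [frob, ← Matrix.conjTranspose_eq_transpose_of_trivial] at this
  exact Matrix.trace_conjTranspose_mul_self_eq_zero_iff.1 this

theorem frob_ext {A B : Matrix (Fin n) (Fin m) ℝ} (h : ∀ C, frob A C = frob B C) : A = B :=
  sub_eq_zero.1 (frob_eq_zero_of_forall fun C => by rw [frob_sub_left, h, sub_self])

theorem l2_sq (v : Fin m → ℝ) : l2 v ^ 2 = v ⬝ᵥ v := by
  rw [EuclideanSpace.norm_sq_eq]
  simp [dotProduct, sq]

theorem l2_nonneg (v : Fin m → ℝ) : 0 ≤ l2 v := norm_nonneg _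

theorem abs_dotProduct_le (v w : Fin m → ℝ) : |v ⬝ᵥ w| ≤ l2 v * l2 w := by
  have := abs_real_inner_le_norm (WithLp.toLp 2 w) (WithLp.toLp 2 v)
  rw [EuclideanSpace.inner_toLp_toLp, mul_comm] at this
  simpa using this

theorem norm_sq_eq_sum_rows (A : Matrix (Fin n) (Fin m) ℝ) : ‖A‖ ^ 2 = ∑ i, l2 (A i) ^ 2 := by
  rw [Matrix.frobenius_norm_def, ← Real.sqrt_eq_rpow, Real.sq_sqrt (by positivity)]
  refine Finset.sum_congr rfl fun i _ => ?_
  rw [l2_sq]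
  simp [dotProduct, sq]

theorem frob_self (A : Matrix (Fin n) (Fin m) ℝ) : frob A A = ‖A‖ ^ 2 := by
  simp [norm_sq_eq_sum_rows, frob_eq_sum, l2_sq]

theorem norm_add_sq_frob (A B : Matrix (Fin n) (Fin m) ℝ) :
    ‖A + B‖ ^ 2 = ‖A‖ ^ 2 + 2 * frob A B + ‖B‖ ^ 2 := by
  simp only [← frob_self, frob_add_left, frob_add_right, frob_comm B A]; ring

theorem norm_sub_sq_frob (A B : Matrix (Fin n) (Fin m) ℝ) :
    ‖A - B‖ ^ 2 = ‖A‖ ^ 2 - 2 * frob A B + ‖B‖ ^ 2 := by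
  simp only [← frob_self, frob_sub_left, frob_sub_right, frob_comm B A]; ring

theorem abs_frob_le (A B : Matrix (Fin n) (Fin m) ℝ) : |frob A B| ≤ ‖A‖ * ‖B‖ := by
  rw [frob_eq_sum]
  calc |∑ i, A i ⬝ᵥ B i| ≤ ∑ i, l2 (A i) * l2 (B i) :=
        (Finset.abs_sum_le_sum_abs _ _).trans (Finset.sum_le_sum fun i _ => abs_dotProduct_le _ _)
    _ ≤ √(∑ i, l2 (A i) ^ 2) * √(∑ i, l2 (B i) ^ 2) :=
        Real.sum_mul_le_sqrt_mul_sqrt _ _ _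
    _ = ‖A‖ * ‖B‖ := by
        rw [← norm_sq_eq_sum_rows, ← norm_sq_eq_sum_rows, Real.sqrt_sq (norm_nonneg _),
          Real.sqrt_sq (norm_nonneg _)]

theorem norm_mul_orthogonal (A : Matrix (Fin n) (Fin m) ℝ) {Q : Matrix (Fin m) (Fin m) ℝ}
    (hQ : Q * Qᵀ = 1) : ‖A * Q‖ = ‖A‖ := by
  have : ‖A * Q‖ ^ 2 = ‖A‖ ^ 2 := by
    rw [← frob_self, frob_mul_eq_right, Matrix.mul_assoc, hQ, Matrix.mul_one, frob_self]
  exact (sq_eq_sq₀ (norm_nonneg _) (norm_nonneg _)).1 this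

end Frob

/-! ### Row, operator and Frobenius norms. -/

section Norms
variable {n m k : ℕ}

theorem l2_row_le_norm (A : Matrix (Fin n) (Fin m) ℝ) (i : Fin n) : l2 (A i) ≤ ‖A‖ := by
  refine le_of_sq_le_sq ?_ (norm_nonneg _)
  rw [norm_sq_eq_sum_rows]
  exact Finset.single_le_sum (f := fun i => l2 (A i) ^ 2) (fun _ _ => sq_nonneg _)
    (Finset.mem_univ i)

theorem l2_row_le_twoInfNorm (A : Matrix (Fin n) (Fin m) ℝ) (i : Fin n) :
    l2 (A i) ≤ twoInfNorm A :=
  le_ciSup (f := fun i => l2 (A i)) (Set.finite_range _).bddAbove i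

theorem twoInfNorm_nonneg (A : Matrix (Fin n) (Fin m) ℝ) : 0 ≤ twoInfNorm A :=
  Real.iSup_nonneg fun _ => norm_nonneg _

theorem twoInfNorm_le {A : Matrix (Fin n) (Fin m) ℝ} {c : ℝ} (hc : 0 ≤ c)
    (h : ∀ i, l2 (A i) ≤ c) : twoInfNorm A ≤ c :=
  Real.iSup_le h hc

theorem twoInfNorm_le_norm (A : Matrix (Fin n) (Fin m) ℝ) : twoInfNorm A ≤ ‖A‖ :=
  twoInfNorm_le (norm_nonneg _) (l2_row_le_norm A)

theorem l2_add_le (v w : Fin m → ℝ) : l2 (v + w) ≤ l2 v + l2 w := by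
  simpa [l2] using norm_add_le (WithLp.toLp 2 v) (WithLp.toLp 2 w)

theorem l2_smul (c : ℝ) (v : Fin m → ℝ) : l2 (c • v) = |c| * l2 v := by
  simp [l2, norm_smul]

theorem twoInfNorm_add_le (A B : Matrix (Fin n) (Fin m) ℝ) :
    twoInfNorm (A + B) ≤ twoInfNorm A + twoInfNorm B :=
  twoInfNorm_le (add_nonneg (twoInfNorm_nonneg _) (twoInfNorm_nonneg _)) fun i =>
    (l2_add_le (A i) (B i)).trans
      (add_le_add (l2_row_le_twoInfNorm A i) (l2_row_le_twoInfNorm B i))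

theorem twoInfNorm_smul_le {c : ℝ} (hc : 0 ≤ c) (A : Matrix (Fin n) (Fin m) ℝ) :
    twoInfNorm (c • A) ≤ c * twoInfNorm A :=
  twoInfNorm_le (mul_nonneg hc (twoInfNorm_nonneg _)) fun i => by
    have : (c • A) i = c • A i := rfl
    rw [this, l2_smul, abs_of_nonneg hc]
    exact mul_le_mul_of_nonneg_left (l2_row_le_twoInfNorm A i) hc

theorem opNorm_nonneg (A : Matrix (Fin n) (Fin m) ℝ) : 0 ≤ opNorm A := norm_nonneg _

theorem l2_mulVec_le_opNorm (A : Matrix (Fin n) (Fin m) ℝ) (v : Fin m → ℝ) :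
    l2 (A *ᵥ v) ≤ opNorm A * l2 v := by
  exact
    (Matrix.toEuclideanLin A).toContinuousLinearMap.le_opNorm (WithLp.toLp 2 v)

theorem opNorm_le {A : Matrix (Fin n) (Fin m) ℝ} {c : ℝ} (hc : 0 ≤ c)
    (h : ∀ v, l2 (A *ᵥ v) ≤ c * l2 v) : opNorm A ≤ c := by
  refine ContinuousLinearMap.opNorm_le_bound _ hc fun x => ?_
  exact h x.ofLp

theorem row_mul_transpose (A : Matrix (Fin n) (Fin m) ℝ) (B : Matrix (Fin k) (Fin m) ℝ)
    (i : Fin k) : (B * Aᵀ) i = A *ᵥ B i := by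
  ext j
  simp [Matrix.mul_apply, Matrix.mulVec, dotProduct, mul_comm]

theorem norm_mul_transpose_le {A : Matrix (Fin n) (Fin m) ℝ} {c : ℝ} (hc : 0 ≤ c)
    (h : ∀ v, l2 (A *ᵥ v) ≤ c * l2 v) (B : Matrix (Fin k) (Fin m) ℝ) :
    ‖B * Aᵀ‖ ≤ c * ‖B‖ := by
  refine le_of_sq_le_sq ?_ (by positivity)
  rw [mul_pow, norm_sq_eq_sum_rows, norm_sq_eq_sum_rows, Finset.mul_sum]
  refine Finset.sum_le_sum fun i _ => ?_
  rw [row_mul_transpose, ← mul_pow]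
  gcongr
  exact h _

theorem le_norm_mul_transpose {A : Matrix (Fin n) (Fin m) ℝ} {c : ℝ} (hc : 0 ≤ c)
    (h : ∀ v, c * l2 v ≤ l2 (A *ᵥ v)) (B : Matrix (Fin k) (Fin m) ℝ) :
    c * ‖B‖ ≤ ‖B * Aᵀ‖ := by
  refine le_of_sq_le_sq ?_ (norm_nonneg _)
  rw [mul_pow, norm_sq_eq_sum_rows, norm_sq_eq_sum_rows, Finset.mul_sum]
  refine Finset.sum_le_sum fun i _ => ?_
  rw [row_mul_transpose, ← mul_pow]
  have := l2_nonneg (B i)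
  gcongr
  exact h _

theorem norm_mul_le_of_mulVec_le {A : Matrix (Fin n) (Fin m) ℝ} {c : ℝ} (hc : 0 ≤ c)
    (h : ∀ v, l2 (A *ᵥ v) ≤ c * l2 v) (B : Matrix (Fin m) (Fin k) ℝ) :
    ‖A * B‖ ≤ c * ‖B‖ := by
  have := norm_mul_transpose_le hc h Bᵀ
  rwa [← Matrix.transpose_mul, Matrix.frobenius_norm_transpose, Matrix.frobenius_norm_transpose]
    at this

theorem norm_mul_le_opNorm (A : Matrix (Fin n) (Fin m) ℝ) (B : Matrix (Fin m) (Fin k) ℝ) :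
    ‖A * B‖ ≤ opNorm A * ‖B‖ :=
  norm_mul_le_of_mulVec_le (opNorm_nonneg A) (l2_mulVec_le_opNorm A) B

/-- Duality: pair `Aᵀ * B` with itself, move `A` across, and cancel one factor of the norm. -/
theorem norm_transpose_mul_le {A : Matrix (Fin n) (Fin m) ℝ} {c : ℝ} (hc : 0 ≤ c)
    (h : ∀ v, l2 (A *ᵥ v) ≤ c * l2 v) (B : Matrix (Fin n) (Fin k) ℝ) :
    ‖Aᵀ * B‖ ≤ c * ‖B‖ := by
  have h1 : ‖Aᵀ * B‖ ^ 2 ≤ (c * ‖B‖) * ‖Aᵀ * B‖ := by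
    rw [← frob_self, frob_mul_eq_left, Matrix.transpose_transpose]
    calc _ ≤ ‖B‖ * ‖A * (Aᵀ * B)‖ := (le_abs_self _).trans (abs_frob_le _ _)
      _ ≤ ‖B‖ * (c * ‖Aᵀ * B‖) := by gcongr; exact norm_mul_le_of_mulVec_le hc h _
      _ = _ := by ring
  rcases (norm_nonneg (Aᵀ * B)).eq_or_lt with h0 | h0
  · rw [← h0]; positivity
  · rw [sq] at h1; exact le_of_mul_le_mul_right h1 h0

theorem l2_eq_norm_replicateCol (v : Fin m → ℝ) : l2 v = ‖Matrix.replicateCol (Fin 1) v‖ :=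
  (Matrix.frobenius_norm_replicateCol v).symm

theorem l2_mulVec_le_norm (A : Matrix (Fin n) (Fin m) ℝ) (v : Fin m → ℝ) :
    l2 (A *ᵥ v) ≤ ‖A‖ * l2 v := by
  rw [l2_eq_norm_replicateCol, l2_eq_norm_replicateCol, Matrix.replicateCol_mulVec]
  exact Matrix.frobenius_norm_mul _ _

theorem norm_vecMulVec_single (i : Fin n) (v : Fin m → ℝ) :
    ‖Matrix.vecMulVec (Pi.single i (1 : ℝ)) v‖ = l2 v := by
  refine (sq_eq_sq₀ (norm_nonneg _) (norm_nonneg _)).1 ?_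
  rw [norm_sq_eq_sum_rows, Finset.sum_eq_single i]
  · congr 2; ext j; simp [Matrix.vecMulVec_apply]
  · intro j _ hj
    have : Matrix.vecMulVec (Pi.single i (1 : ℝ)) v j = 0 := by
      ext k; simp [Matrix.vecMulVec_apply, hj]
    rw [this]; simp
  · simp

theorem frob_vecMulVec_single (A : Matrix (Fin n) (Fin m) ℝ) (i : Fin n) (v : Fin m → ℝ) :
    frob A (Matrix.vecMulVec (Pi.single i (1 : ℝ)) v) = A i ⬝ᵥ v := by
  rw [frob_eq_sum, Finset.sum_eq_single i]
  · congr 1; ext j; simp [Matrix.vecMulVec_apply]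
  · intro j _ hj
    have : Matrix.vecMulVec (Pi.single i (1 : ℝ)) v j = 0 := by
      ext k; simp [Matrix.vecMulVec_apply, hj]
    rw [this]; simp
  · simp

end Norms

/-! ### Singular values as bounds for a linear map. -/

section SingularValues
open Module InnerProductSpace LinearMap
variable {E F : Type*} [NormedAddCommGroup E] [InnerProductSpace ℝ E] [FiniteDimensional ℝ E]
  [NormedAddCommGroup F] [InnerProductSpace ℝ F] [FiniteDimensional ℝ F] (T : E →ₗ[ℝ] F)

theorem norm_apply_sq_eq_sum_singularValues (x : E) :
    ‖T x‖ ^ 2 = ∑ i : Fin (finrank ℝ E), T.singularValues i ^ 2 *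
      inner ℝ (T.isSymmetric_adjoint_comp_self.eigenvectorBasis rfl i) x ^ 2 := by
  have h1 : ‖T x‖ ^ 2 = inner ℝ x ((adjoint T ∘ₗ T) x) := by
    rw [LinearMap.comp_apply, adjoint_inner_right, real_inner_self_eq_norm_sq]
  rw [h1, ← (T.isSymmetric_adjoint_comp_self.eigenvectorBasis rfl).sum_inner_mul_inner]
  refine Finset.sum_congr rfl fun i _ => ?_
  have h2 := T.isSymmetric_adjoint_comp_self.eigenvectorBasis_apply_self_apply rfl x i
  rw [OrthonormalBasis.repr_apply_apply, OrthonormalBasis.repr_apply_apply] at h2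
  rw [h2, T.sq_singularValues_fin rfl, real_inner_comm x]
  simp only [RCLike.ofReal_real_eq_id, id_eq]
  ring

theorem norm_apply_le_singularValues_zero (x : E) : ‖T x‖ ≤ T.singularValues 0 * ‖x‖ := by
  refine le_of_sq_le_sq ?_ (mul_nonneg (T.singularValues_nonneg 0) (norm_nonneg _))
  rw [norm_apply_sq_eq_sum_singularValues, mul_pow,
    ← (T.isSymmetric_adjoint_comp_self.eigenvectorBasis rfl).sum_sq_norm_inner_right x,
    Finset.mul_sum]
  refine Finset.sum_le_sum fun i _ => ?_
  have := T.singularValues_nonneg i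
  have := T.singularValues_antitone (Nat.zero_le i)
  rw [Real.norm_eq_abs, sq_abs]
  gcongr

/-- Indices start at `0`, so `finrank - 1` is the last nonzero singular value. Singular vectors of
larger index span the kernel, where `x` has no component. -/
theorem singularValues_mul_norm_le {x : E} (hx : ∀ y, T y = 0 → inner ℝ y x = 0) :
    T.singularValues (finrank ℝ T.range - 1) * ‖x‖ ≤ ‖T x‖ := by
  refine le_of_sq_le_sq ?_ (norm_nonneg _)
  rw [norm_apply_sq_eq_sum_singularValues, mul_pow,
    ← (T.isSymmetric_adjoint_comp_self.eigenvectorBasis rfl).sum_sq_norm_inner_right x,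
    Finset.mul_sum]
  refine Finset.sum_le_sum fun i _ => ?_
  rw [Real.norm_eq_abs, sq_abs]
  rcases lt_or_ge (i : ℕ) (finrank ℝ T.range) with hi | hi
  · have := T.singularValues_nonneg (finrank ℝ T.range - 1)
    have := T.singularValues_antitone (Nat.le_sub_one_of_lt hi)
    gcongr
  · have h0 := T.singularValues_eq_zero_iff_le_finrank_range.2 hi
    have h1 : T (T.isSymmetric_adjoint_comp_self.eigenvectorBasis rfl i) = 0 := by
      have h2 := T.isSymmetric_adjoint_comp_self.apply_eigenvectorBasis rfl i
      rw [← T.sq_singularValues_fin rfl, h0] at h2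
      have h3 : ‖T (T.isSymmetric_adjoint_comp_self.eigenvectorBasis rfl i)‖ ^ 2 = 0 := by
        rw [← real_inner_self_eq_norm_sq, ← adjoint_inner_right, ← LinearMap.comp_apply, h2]
        simp
      simpa using h3
    rw [hx _ h1]
    simp

/-- The bound is immediate for `adjoint T`, whose squared norm is a quadratic form of `T ∘ₗ adjoint
T`; duality carries it over to `T`. -/
theorem norm_apply_sq_le_singularValues_self_comp_adjoint (x : E) :
    ‖T x‖ ^ 2 ≤ (T ∘ₗ adjoint T).singularValues 0 * ‖x‖ ^ 2 := by
  set c := (T ∘ₗ adjoint T).singularValues 0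
  have hc : 0 ≤ c := singularValues_nonneg _ _
  have h1 (y : F) : ‖adjoint T y‖ ^ 2 ≤ c * ‖y‖ ^ 2 := by
    rw [← real_inner_self_eq_norm_sq, adjoint_inner_left, ← LinearMap.comp_apply]
    calc _ ≤ ‖y‖ * ‖(T ∘ₗ adjoint T) y‖ := real_inner_le_norm _ _
      _ ≤ ‖y‖ * (c * ‖y‖) := by gcongr; exact norm_apply_le_singularValues_zero _ y
      _ = _ := by ring
  have h2 : ‖T x‖ ^ 2 ≤ ‖x‖ * ‖adjoint T (T x)‖ := by
    rw [← real_inner_self_eq_norm_sq, ← adjoint_inner_right]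
    exact real_inner_le_norm _ _
  have h3 : (‖T x‖ ^ 2) ^ 2 ≤ (c * ‖x‖ ^ 2) * ‖T x‖ ^ 2 := by
    calc (‖T x‖ ^ 2) ^ 2 ≤ (‖x‖ * ‖adjoint T (T x)‖) ^ 2 := by gcongr
      _ = ‖x‖ ^ 2 * ‖adjoint T (T x)‖ ^ 2 := by ring
      _ ≤ ‖x‖ ^ 2 * (c * ‖T x‖ ^ 2) := by gcongr; exact h1 _
      _ = _ := by ring
  rcases (sq_nonneg ‖T x‖).eq_or_lt with h0 | h0
  · rw [← h0]; positivity
  · rw [sq (‖T x‖ ^ 2)] at h3; exact le_of_mul_le_mul_right h3 h0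

/-- It suffices that the last nonzero singular value of `T ∘ₗ adjoint T` is at most `s ^ 2`, with
`s` the smallest one of `T`. If `v` is an eigenvector of `adjoint T ∘ₗ T` for `s ^ 2`, then `T v` is
one of `T ∘ₗ adjoint T` orthogonal to its kernel, so the previous lower bound applies to `T v`. -/
theorem singularValues_self_comp_adjoint_mul_le (hT : Function.Injective T) (x : E) :
    (T ∘ₗ adjoint T).singularValues (finrank ℝ E - 1) * ‖x‖ ^ 2 ≤ ‖T x‖ ^ 2 := by
  rcases Nat.eq_zero_or_pos (finrank ℝ E) with hE | hE
  · have := (finrank_zero_iff (R := ℝ) (M := E)).1 hE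
    rw [Subsingleton.elim x 0]; simp
  have hrange : finrank ℝ T.range = finrank ℝ E := finrank_range_of_inj hT
  set s := T.singularValues (finrank ℝ E - 1)
  obtain ⟨v, hv⟩ := (T.hasEigenvalue_adjoint_comp_self_sq_singularValues
    (n := finrank ℝ E - 1) (by omega)).exists_hasEigenvector
  have hTv : 0 < ‖T v‖ := norm_pos_iff.2 fun h => hv.2 (hT (by simpa using h))
  have h1 : (T ∘ₗ adjoint T) (T v) = s ^ 2 • T v := by
    have := hv.apply_eq_smul
    rw [LinearMap.comp_apply] at this ⊢
    rw [this, map_smul]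
    rfl
  have h2 := singularValues_mul_norm_le (T ∘ₗ adjoint T) (x := T v) fun y hy => by
    have : adjoint T y = 0 := by
      have h3 : inner ℝ y ((T ∘ₗ adjoint T) y) = 0 := by rw [hy]; simp
      rw [LinearMap.comp_apply, ← adjoint_inner_left] at h3
      simpa using h3
    rw [← adjoint_inner_left, this]; simp
  have h4 : finrank ℝ (T ∘ₗ adjoint T).range = finrank ℝ E := by
    have := (adjoint T).range_adjoint_comp_self
    rw [adjoint_adjoint] at this
    rw [this, hrange]
  rw [h4, h1, norm_smul, Real.norm_of_nonneg (sq_nonneg s)] at h2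
  have h5 := le_of_mul_le_mul_right h2 hTv
  have h6 := singularValues_mul_norm_le T (x := x) fun y hy => by
    rw [hT (a₁ := y) (a₂ := 0) (by simpa using hy)]; simp
  rw [hrange] at h6
  calc _ ≤ s ^ 2 * ‖x‖ ^ 2 := by gcongr
    _ = (s * ‖x‖) ^ 2 := by ring
    _ ≤ _ := by
      have := mul_nonneg (T.singularValues_nonneg (finrank ℝ E - 1)) (norm_nonneg x)
      gcongr

end SingularValues

/-! ### Spectral bounds for `Zs` from the singular values of `Zs * Zsᵀ`. -/

section Sigma
variable {n r : ℕ} (Zs : Matrix (Fin n) (Fin r) ℝ)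

theorem toEuclideanLin_mul_transpose :
    Matrix.toEuclideanLin (Zs * Zsᵀ) =
      Matrix.toEuclideanLin Zs ∘ₗ LinearMap.adjoint (Matrix.toEuclideanLin Zs) := by
  rw [← Matrix.toEuclideanLin_conjTranspose_eq_adjoint, ← Matrix.toLpLin_mul_same,
    Matrix.conjTranspose_eq_transpose_of_trivial]

theorem l2_mulVec_sq_le_sigma (v : Fin r → ℝ) :
    l2 (Zs *ᵥ v) ^ 2 ≤ sigma 1 (Zs * Zsᵀ) * l2 v ^ 2 := by
  rw [sigma, toEuclideanLin_mul_transpose]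
  exact norm_apply_sq_le_singularValues_self_comp_adjoint (Matrix.toEuclideanLin Zs)
    (WithLp.toLp 2 v)

theorem injective_toEuclideanLin_of_rank (h : Zs.rank = r) :
    Function.Injective (Matrix.toEuclideanLin Zs) := by
  have h1 : Function.Injective Zs.mulVecLin := by
    rw [← LinearMap.ker_eq_bot, ← Submodule.finrank_eq_zero]
    have h2 := Zs.mulVecLin.finrank_range_add_finrank_ker
    rw [← Matrix.rank, h] at h2
    simpa using h2
  intro x y hxy
  have : Zs.mulVecLin x.ofLp = Zs.mulVecLin y.ofLp := congrArg WithLp.ofLp hxy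
  exact WithLp.ofLp_injective 2 (h1 this)

theorem sigma_mul_l2_sq_le (h : Zs.rank = r) (v : Fin r → ℝ) :
    sigma r (Zs * Zsᵀ) * l2 v ^ 2 ≤ l2 (Zs *ᵥ v) ^ 2 := by
  rw [sigma, toEuclideanLin_mul_transpose]
  have := singularValues_self_comp_adjoint_mul_le (Matrix.toEuclideanLin Zs)
    (injective_toEuclideanLin_of_rank Zs h) (WithLp.toLp 2 v)
  rw [finrank_euclideanSpace_fin] at this
  exact this

theorem sigma_pos_of_rank (hr : 0 < r) (h : Zs.rank = r) : 0 < sigma r (Zs * Zsᵀ) := by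
  rw [sigma, LinearMap.singularValues_pos_iff_lt_finrank_range, toEuclideanLin_mul_transpose]
  have := (LinearMap.adjoint (Matrix.toEuclideanLin Zs)).range_adjoint_comp_self
  rw [LinearMap.adjoint_adjoint] at this
  rw [this, LinearMap.finrank_range_of_inj (injective_toEuclideanLin_of_rank Zs h),
    finrank_euclideanSpace_fin]
  omega

theorem sigma_le_sigma_one : sigma r (Zs * Zsᵀ) ≤ sigma 1 (Zs * Zsᵀ) :=
  LinearMap.singularValues_antitone _ (Nat.zero_le _)

theorem norm_sq_le_of_l2_mulVec_sq_le {c : ℝ} (h : ∀ v, l2 (Zs *ᵥ v) ^ 2 ≤ c * l2 v ^ 2) :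
    ‖Zs‖ ^ 2 ≤ r * c := by
  rw [← Matrix.frobenius_norm_transpose, norm_sq_eq_sum_rows]
  calc ∑ j, l2 (Zsᵀ j) ^ 2 ≤ ∑ _j : Fin r, c := by
        refine Finset.sum_le_sum fun j _ => ?_
        have h1 := h (Pi.single j 1)
        rw [Matrix.mulVec_single_one] at h1
        have h2 : l2 (Pi.single j (1 : ℝ)) ^ 2 = 1 := by rw [l2_sq]; simp
        rw [h2, mul_one] at h1
        exact h1
    _ = r * c := by simp

end Sigma

/-! ### Orthogonal Procrustes alignment. -/

section Procrustes
variable {n r : ℕ}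

theorem IsProcrustes.frob_le {Z Zs : Matrix (Fin n) (Fin r) ℝ} {R Q : Matrix (Fin r) (Fin r) ℝ}
    (h : IsProcrustes Z Zs R) (hQ : Q * Qᵀ = 1) : frob (Z * Q) Zs ≤ frob (Z * R) Zs := by
  have h1 := pow_le_pow_left₀ (norm_nonneg _) (h.2 Q hQ) 2
  rw [norm_sub_sq_frob, norm_sub_sq_frob, norm_mul_orthogonal Z h.1,
    norm_mul_orthogonal Z hQ] at h1
  linarith

theorem norm_mul_procrustes_sub_le (Z Zs : Matrix (Fin n) (Fin r) ℝ)
    {Q : Matrix (Fin r) (Fin r) ℝ} (hQ : Q * Qᵀ = 1) : distTwo Z Zs ≤ ‖Z * Q - Zs‖ :=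
  (procrustes_spec Z Zs).2 Q hQ

theorem distTwo_le (Z Zs : Matrix (Fin n) (Fin r) ℝ) : distTwo Z Zs ≤ ‖Z - Zs‖ := by
  simpa using norm_mul_procrustes_sub_le Z Zs (Q := 1) (by simp)

theorem distInf_le_distTwo (Z Zs : Matrix (Fin n) (Fin r) ℝ) : distInf Z Zs ≤ distTwo Z Zs :=
  twoInfNorm_le_norm _

theorem exp_smul_mul_transpose {K : Matrix (Fin r) (Fin r) ℝ} (hK : Kᵀ = -K) (t : ℝ) :
    NormedSpace.exp (t • K) * (NormedSpace.exp (t • K))ᵀ = 1 := by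
  have h1 : (t • K)ᵀ = -(t • K) := by rw [Matrix.transpose_smul, hK, smul_neg]
  rw [← Matrix.exp_transpose, h1, Matrix.exp_neg]
  exact Matrix.mul_nonsing_inv _ ((Matrix.isUnit_iff_isUnit_det _).1 (Matrix.isUnit_exp _))

theorem hasDerivAt_frob_exp_smul (A K : Matrix (Fin r) (Fin r) ℝ) :
    HasDerivAt (fun t : ℝ => frob A (NormedSpace.exp (t • K))) (frob A K) 0 := by
  have h1 : HasDerivAt (fun t : ℝ => NormedSpace.exp (t • K)) K 0 := by
    have := hasDerivAt_exp_smul_const (𝕂 := ℝ) K (0 : ℝ)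
    rwa [zero_smul, NormedSpace.exp_zero, one_mul] at this
  let ℓ : Matrix (Fin r) (Fin r) ℝ →ₗ[ℝ] ℝ :=
    { toFun := fun B => frob A B
      map_add' := frob_add_right _
      map_smul' := fun c B => frob_smul_right c A B }
  exact ℓ.toContinuousLinearMap.hasFDerivAt.comp_hasDerivAt (0 : ℝ) h1

/-- First-order optimality: `R` maximises `frob (Z * Q) Zs` over orthogonal `Q`, so the derivative
along `R * exp (t • K)` vanishes for skew `K`. For `K = Mᵀ - M` this derivative is half of `‖K‖ ^
2`. -/
theorem IsProcrustes.transpose_mul_comm {Z Zs : Matrix (Fin n) (Fin r) ℝ}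
    {R : Matrix (Fin r) (Fin r) ℝ} (h : IsProcrustes Z Zs R) :
    (Zsᵀ * (Z * R))ᵀ = Zsᵀ * (Z * R) := by
  set M := Zsᵀ * (Z * R) with hM
  set K := Mᵀ - M with hK
  have hKt : Kᵀ = -K := by simp [hK]
  set f : ℝ → ℝ := fun t => frob Mᵀ (NormedSpace.exp (t • K))
  have hf (t : ℝ) : f t = frob (Z * (R * NormedSpace.exp (t • K))) Zs := by
    rw [frob_comm, ← Matrix.mul_assoc, ← frob_transpose, Matrix.transpose_mul, frob_comm,
      frob_mul_eq_right, Matrix.transpose_transpose, ← frob_transpose]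
    simp only [f, hM, Matrix.transpose_mul, Matrix.transpose_transpose, Matrix.mul_assoc]
    rw [frob_comm]
  have horth (t : ℝ) : (R * NormedSpace.exp (t • K)) * (R * NormedSpace.exp (t • K))ᵀ = 1 := by
    rw [Matrix.transpose_mul, Matrix.mul_assoc, ← Matrix.mul_assoc _ _ Rᵀ,
      exp_smul_mul_transpose hKt, Matrix.one_mul, h.1]
  have hmax : IsLocalMax f 0 := Filter.Eventually.of_forall fun t => by
    rw [hf, hf 0]
    simpa using h.frob_le (horth t)
  have hderiv : HasDerivAt f (frob Mᵀ K) 0 := hasDerivAt_frob_exp_smul _ _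
  have h0 := hmax.hasDerivAt_eq_zero hderiv
  have h3 : ‖K‖ ^ 2 = 0 := by
    have h4 : frob M K = -frob Mᵀ K := by
      rw [← frob_transpose M K, hKt, ← neg_one_smul ℝ K, frob_smul_right]; ring
    rw [← frob_self]
    nth_rw 1 [hK]
    rw [frob_sub_left, h4, h0]; ring
  have h5 : K = 0 := by simpa using h3
  exact sub_eq_zero.1 h5

theorem dotProduct_mul_mulVec_eq (A B : Matrix (Fin n) (Fin r) ℝ) (v : Fin r → ℝ) :
    v ⬝ᵥ ((Aᵀ * B) *ᵥ v) = (A *ᵥ v) ⬝ᵥ (B *ᵥ v) := by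
  rw [← Matrix.mulVec_mulVec, Matrix.dotProduct_mulVec, Matrix.vecMul_transpose]

theorem norm_sq_le_frob_mul {N : Matrix (Fin r) (Fin r) ℝ} {a : ℝ}
    (hN : ∀ v, a * l2 v ^ 2 ≤ v ⬝ᵥ (N *ᵥ v)) (B : Matrix (Fin r) (Fin n) ℝ) :
    a * ‖B‖ ^ 2 ≤ frob B (N * B) := by
  rw [← Matrix.frobenius_norm_transpose, norm_sq_eq_sum_rows, ← frob_transpose, frob_eq_sum,
    Finset.mul_sum]
  refine Finset.sum_le_sum fun i _ => ?_
  rw [Matrix.transpose_mul, row_mul_transpose]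
  exact hN _

/-- The polar factor of a positive matrix is close to the identity if the matrix is nearly
symmetric. -/
theorem norm_one_sub_le_of_trace_le {N R : Matrix (Fin r) (Fin r) ℝ} {a : ℝ}
    (hN : ∀ v, a * l2 v ^ 2 ≤ v ⬝ᵥ (N *ᵥ v)) (hR : R * Rᵀ = 1)
    (htr : N.trace ≤ (N * R).trace) : a * ‖R - 1‖ ≤ ‖N - Nᵀ‖ := by
  have h1 := norm_sq_le_frob_mul hN (R - 1)
  have hR' : Rᵀ * R = 1 := mul_eq_one_comm.1 hR
  -- Orthogonality removes the term quadratic in `R`. The trace difference is nonpositive by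
  -- hypothesis, so only the skew part of `N` can push `R` away from the identity; no polar
  -- decomposition is needed.
  have e1 : frob (R - 1) (N * (R - 1)) =
      2 * (N.trace - (N * R).trace) - frob (N - Nᵀ) (R - 1) := by
    have t1 : (Rᵀ * (N * R)).trace = N.trace := by
      rw [Matrix.trace_mul_comm, Matrix.mul_assoc, hR, Matrix.mul_one]
    have t2 : (Rᵀ * N).trace = (Nᵀ * R).trace := by
      rw [← Matrix.trace_transpose, Matrix.transpose_mul, Matrix.transpose_transpose]
    simp only [frob, Matrix.transpose_sub, Matrix.transpose_one, Matrix.transpose_transpose,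
      Matrix.sub_mul, Matrix.mul_sub, Matrix.one_mul, Matrix.mul_one, Matrix.trace_sub, t1, t2,
      Matrix.trace_transpose]
    ring
  have h2 : a * ‖R - 1‖ ^ 2 ≤ ‖N - Nᵀ‖ * ‖R - 1‖ := by
    have := (neg_le_abs _).trans (abs_frob_le (N - Nᵀ) (R - 1))
    linarith
  rcases (norm_nonneg (R - 1)).eq_or_lt with h0 | h0
  · rw [← h0]; simp
  · rw [sq, ← mul_assoc] at h2; exact le_of_mul_le_mul_right h2 h0

theorem trace_transpose_mul_le_of_isProcrustes {Z Zs : Matrix (Fin n) (Fin r) ℝ}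
    {R : Matrix (Fin r) (Fin r) ℝ} (h : IsProcrustes Z Zs R) :
    (Zsᵀ * Z).trace ≤ (Zsᵀ * Z * R).trace := by
  have := h.frob_le (Q := 1) (by simp)
  rw [frob_comm, frob_comm _ Zs, frob, frob, Matrix.mul_one] at this
  rwa [Matrix.mul_assoc]

/-- When `Zsᵀ * Z` is symmetric positive definite the minimiser is unique, so the arbitrary choice
in `procrustes` must be the identity. -/
theorem procrustes_eq_one {Z Zs : Matrix (Fin n) (Fin r) ℝ} {a : ℝ} (ha : 0 < a)
    (hN : ∀ v, a * l2 v ^ 2 ≤ v ⬝ᵥ ((Zsᵀ * Z) *ᵥ v)) (hsymm : (Zsᵀ * Z)ᵀ = Zsᵀ * Z) :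
    procrustes Z Zs = 1 := by
  have h := norm_one_sub_le_of_trace_le hN (procrustes_spec Z Zs).1
    (trace_transpose_mul_le_of_isProcrustes (procrustes_spec Z Zs))
  rw [hsymm, sub_self, norm_zero] at h
  have h1 : ‖procrustes Z Zs - 1‖ = 0 :=
    le_antisymm (nonpos_of_mul_nonpos_right h ha) (norm_nonneg _)
  exact sub_eq_zero.1 (norm_eq_zero.1 h1)

theorem le_dotProduct_transpose_mul_mulVec {Z Zs : Matrix (Fin n) (Fin r) ℝ} {s d : ℝ}
    (hlow : ∀ v, s * l2 v ≤ l2 (Zs *ᵥ v)) (hd : ‖Z - Zs‖ ≤ d) (hds : d ≤ s)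
    (v : Fin r → ℝ) : s * (s - d) * l2 v ^ 2 ≤ v ⬝ᵥ ((Zsᵀ * Z) *ᵥ v) := by
  have h1 : Z *ᵥ v = Zs *ᵥ v + (Z - Zs) *ᵥ v := by rw [Matrix.sub_mulVec]; abel
  rw [dotProduct_mul_mulVec_eq, h1, dotProduct_add, ← l2_sq]
  have h2 := neg_abs_le ((Zs *ᵥ v) ⬝ᵥ ((Z - Zs) *ᵥ v))
  have h3 := abs_dotProduct_le (Zs *ᵥ v) ((Z - Zs) *ᵥ v)
  have h4 : l2 ((Z - Zs) *ᵥ v) ≤ d * l2 v :=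
    (l2_mulVec_le_norm _ _).trans (mul_le_mul_of_nonneg_right hd (l2_nonneg v))
  have h5 := hlow v
  have h6 := l2_nonneg (Zs *ᵥ v)
  have h7 := mul_le_mul_of_nonneg_left h4 h6
  have h8 : 0 ≤ (s - d) * l2 v := mul_nonneg (by linarith) (l2_nonneg v)
  have h9 : (s * l2 v) * ((s - d) * l2 v) ≤ l2 (Zs *ᵥ v) * (l2 (Zs *ᵥ v) - d * l2 v) := by
    have : (s - d) * l2 v ≤ l2 (Zs *ᵥ v) - d * l2 v := by linarith
    exact mul_le_mul h5 this h8 h6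
  nlinarith

end Procrustes

/-! ### Tangent directions of the map `Z ↦ Z * Zᵀ`. -/

section Tangent
variable {n r : ℕ}

theorem tangent_comm (Z W : Matrix (Fin n) (Fin r) ℝ) : tangent Z W = tangent W Z :=
  add_comm _ _

theorem tangent_add (Z V W : Matrix (Fin n) (Fin r) ℝ) :
    tangent Z (V + W) = tangent Z V + tangent Z W := by
  simp only [tangent, Matrix.transpose_add, Matrix.mul_add, Matrix.add_mul]; abel

theorem tangent_smul (Z W : Matrix (Fin n) (Fin r) ℝ) (c : ℝ) :
    tangent Z (c • W) = c • tangent Z W := by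
  simp [tangent]

theorem tangent_sub (Z V W : Matrix (Fin n) (Fin r) ℝ) :
    tangent Z (V - W) = tangent Z V - tangent Z W := by
  simp only [tangent, Matrix.transpose_sub, Matrix.mul_sub, Matrix.sub_mul]; abel

theorem add_smul_mul_transpose (Z W : Matrix (Fin n) (Fin r) ℝ) (s : ℝ) :
    (Z + s • W) * (Z + s • W)ᵀ = Z * Zᵀ + s • tangent Z W + s ^ 2 • (W * Wᵀ) := by
  simp only [tangent, Matrix.transpose_add, Matrix.transpose_smul, Matrix.mul_add, Matrix.add_mul,
    Matrix.smul_mul, Matrix.mul_smul, smul_add, smul_smul, sq]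
  abel

theorem abs_frob_tangent_le (G : Matrix (Fin n) (Fin n) ℝ) (A B : Matrix (Fin n) (Fin r) ℝ) :
    |frob G (tangent A B)| ≤ 2 * opNorm G * ‖A‖ * ‖B‖ := by
  have key (A B : Matrix (Fin n) (Fin r) ℝ) : |frob G (A * Bᵀ)| ≤ opNorm G * ‖A‖ * ‖B‖ := by
    rw [frob_comm, frob_mul_eq_right, Matrix.transpose_transpose]
    calc _ ≤ ‖A‖ * ‖G * B‖ := abs_frob_le _ _
      _ ≤ ‖A‖ * (opNorm G * ‖B‖) := by gcongr; exact norm_mul_le_opNorm _ _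
      _ = _ := by ring
  rw [tangent, frob_add_right]
  calc _ ≤ _ := abs_add_le _ _
    _ ≤ opNorm G * ‖A‖ * ‖B‖ + opNorm G * ‖B‖ * ‖A‖ := add_le_add (key A B) (key B A)
    _ = _ := by ring

theorem norm_tangent_le {Z : Matrix (Fin n) (Fin r) ℝ} {c : ℝ} (hc : 0 ≤ c)
    (h : ∀ v, l2 (Z *ᵥ v) ≤ c * l2 v) (W : Matrix (Fin n) (Fin r) ℝ) :
    ‖tangent Z W‖ ≤ 2 * c * ‖W‖ := by
  have h1 := norm_mul_transpose_le hc h W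
  have h2 : ‖Z * Wᵀ‖ = ‖W * Zᵀ‖ := by
    rw [← Matrix.frobenius_norm_transpose, Matrix.transpose_mul, Matrix.transpose_transpose]
  calc _ ≤ ‖Z * Wᵀ‖ + ‖W * Zᵀ‖ := norm_add_le _ _
    _ ≤ _ := by rw [h2]; linarith

/-- The square expands to `2 ‖W * Zᵀ‖ ^ 2` plus twice the trace of `(Zᵀ * W) ^ 2`. That trace may be
negative in general; the next two lemmas give the cases used here in which it is not. -/
theorem le_norm_tangent_sq {Z W : Matrix (Fin n) (Fin r) ℝ} {c : ℝ} (hc : 0 ≤ c)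
    (h : ∀ v, c * l2 v ≤ l2 (Z *ᵥ v)) (hW : 0 ≤ frob (Wᵀ * Z) (Zᵀ * W)) :
    2 * c ^ 2 * ‖W‖ ^ 2 ≤ ‖tangent Z W‖ ^ 2 := by
  have h1 := pow_le_pow_left₀ (by positivity) (le_norm_mul_transpose hc h W) 2
  have h2 : ‖Z * Wᵀ‖ = ‖W * Zᵀ‖ := by
    rw [← Matrix.frobenius_norm_transpose, Matrix.transpose_mul, Matrix.transpose_transpose]
  have h3 : frob (Z * Wᵀ) (W * Zᵀ) = frob (Wᵀ * Z) (Zᵀ * W) := by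
    rw [frob_mul_eq_left, frob_mul_eq_right, Matrix.mul_assoc]
  rw [tangent, norm_add_sq_frob, h2, h3]
  nlinarith

theorem frob_transpose_mul_nonneg_of_symm {Z W : Matrix (Fin n) (Fin r) ℝ}
    (h : (Zᵀ * W)ᵀ = Zᵀ * W) : 0 ≤ frob (Wᵀ * Z) (Zᵀ * W) := by
  have : Wᵀ * Z = Zᵀ * W := by rw [← h, Matrix.transpose_mul, Matrix.transpose_transpose]
  rw [this, frob_self]
  positivity

/-- For `W = e_i hᵀ` the product `Zᵀ * W` has rank at most one and the trace of its square is `(Z i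
⬝ᵥ h) ^ 2`. Single-row directions thus need no alignment. -/
theorem frob_transpose_mul_nonneg_of_row (Z : Matrix (Fin n) (Fin r) ℝ) (i : Fin n)
    (h : Fin r → ℝ) :
    0 ≤ frob ((Matrix.vecMulVec (Pi.single i 1) h)ᵀ * Z)
      (Zᵀ * Matrix.vecMulVec (Pi.single i 1) h) := by
  have e : Zᵀ * Matrix.vecMulVec (Pi.single i 1) h = Matrix.vecMulVec (Z i) h := by
    rw [Matrix.mul_vecMulVec, Matrix.mulVec_single_one]; rfl
  have e' : (Matrix.vecMulVec (Pi.single i 1) h)ᵀ * Z = Matrix.vecMulVec h (Z i) := by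
    rw [← Matrix.transpose_transpose Z, ← Matrix.transpose_mul, e, Matrix.transpose_vecMulVec]
    rfl
  rw [e, e', frob, Matrix.transpose_vecMulVec, Matrix.vecMulVec_mul_vecMulVec,
    Matrix.vecMulVec_smul, Matrix.trace_smul, Matrix.trace_vecMulVec, dotProduct_comm h]
  exact mul_self_nonneg _

end Tangent

/-! ### Gradients, Hessians and the mean value identity. -/

section Calculus
variable {n m r : ℕ}

theorem fderiv_apply_eq_frob (f : Matrix (Fin n) (Fin m) ℝ → ℝ) (X A : Matrix (Fin n) (Fin m) ℝ) :
    fderiv ℝ f X A = frob (matGrad f X) A := by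
  conv_lhs => rw [Matrix.matrix_eq_sum_single A]
  simp only [map_sum, frob_eq_sum, dotProduct, matGrad, Matrix.of_apply]
  refine Finset.sum_congr rfl fun i _ => Finset.sum_congr rfl fun j _ => ?_
  have : Matrix.single i j (A i j) = A i j • Matrix.single i j (1 : ℝ) := by simp
  rw [this, map_smul, smul_eq_mul, mul_comm]

theorem hasDerivAt_add_smul_mul_transpose (Z W : Matrix (Fin n) (Fin r) ℝ) (s : ℝ) :
    HasDerivAt (fun s : ℝ => (Z + s • W) * (Z + s • W)ᵀ) (tangent (Z + s • W) W) s := by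
  have h1 : HasDerivAt (fun s : ℝ => Z * Zᵀ + s • tangent Z W + s ^ 2 • (W * Wᵀ))
      ((1 : ℝ) • tangent Z W + (2 * s) • (W * Wᵀ)) s := by
    have h2 := (hasDerivAt_id s).smul_const (tangent Z W)
    have h3 := (hasDerivAt_pow 2 s).smul_const (W * Wᵀ)
    have h5 : ((2 : ℕ) : ℝ) * s ^ (2 - 1) = 2 * s := by norm_num
    rw [h5] at h3
    exact (h2.const_add (Z * Zᵀ)).add h3
  have e : (1 : ℝ) • tangent Z W + (2 * s) • (W * Wᵀ) = tangent (Z + s • W) W := by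
    simp only [tangent, Matrix.transpose_add, Matrix.transpose_smul, Matrix.mul_add,
      Matrix.add_mul, Matrix.smul_mul, Matrix.mul_smul, one_smul, two_mul, add_smul]
    abel
  rw [← e]
  exact h1.congr_of_eventuallyEq (Filter.Eventually.of_forall fun s => add_smul_mul_transpose Z W s)

/-- Differentiate along `Z + t • W` in two ways. Stating the chain rule through test directions
avoids any symmetry assumption on the gradient in `X`. -/
theorem frob_matGrad_comp_mul_transpose {L : Matrix (Fin n) (Fin n) ℝ → ℝ}
    {Z : Matrix (Fin n) (Fin r) ℝ} (hL : DifferentiableAt ℝ L (Z * Zᵀ))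
    (W : Matrix (Fin n) (Fin r) ℝ) :
    frob (matGrad (fun Y => L (Y * Yᵀ)) Z) W = frob (gradAt L Z) (tangent Z W) := by
  rw [← fderiv_apply_eq_frob, gradAt, ← fderiv_apply_eq_frob]
  have hq : Differentiable ℝ fun Y : Matrix (Fin n) (Fin r) ℝ => Y * Yᵀ := by
    have hb : IsBoundedBilinearMap ℝ
        fun p : Matrix (Fin n) (Fin r) ℝ × Matrix (Fin r) (Fin n) ℝ => p.1 * p.2 :=
      { add_left := fun _ _ _ => Matrix.add_mul _ _ _
        smul_left := fun _ _ _ => Matrix.smul_mul _ _ _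
        add_right := fun _ _ _ => Matrix.mul_add _ _ _
        smul_right := fun _ _ _ => Matrix.mul_smul _ _ _
        bound := ⟨1, one_pos, fun A B => by simpa using Matrix.frobenius_norm_mul A B⟩ }
    have ht : Differentiable ℝ fun Y : Matrix (Fin n) (Fin r) ℝ => Yᵀ :=
      (Matrix.transposeLinearEquiv (Fin n) (Fin r) ℝ ℝ).toLinearMap.toContinuousLinearMap.differentiable
    exact fun Y => DifferentiableAt.comp (g := fun p : Matrix (Fin n) (Fin r) ℝ × Matrix (Fin r) (Fin n) ℝ =>
      p.1 * p.2) Y (hb.differentiableAt (Y, Yᵀ))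
      (differentiableAt_id.prodMk (ht Y))
  have hf : DifferentiableAt ℝ (fun Y : Matrix (Fin n) (Fin r) ℝ => L (Y * Yᵀ)) Z :=
    hL.comp Z (hq Z)
  have hline : HasDerivAt (fun t : ℝ => Z + t • W) W 0 := by
    have := ((hasDerivAt_id (0 : ℝ)).smul_const W).const_add Z
    rwa [one_smul] at this
  have h1 : HasDerivAt (fun t : ℝ => L ((Z + t • W) * (Z + t • W)ᵀ))
      (fderiv ℝ (fun Y : Matrix (Fin n) (Fin r) ℝ => L (Y * Yᵀ)) Z W) 0 :=
    HasFDerivAt.comp_hasDerivAt_of_eq (0 : ℝ) hf.hasFDerivAt hline (by simp)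
  have h2 : HasDerivAt (fun t : ℝ => L ((Z + t • W) * (Z + t • W)ᵀ))
      (fderiv ℝ L (Z * Zᵀ) (tangent Z W)) 0 := by
    have h3 := hasDerivAt_add_smul_mul_transpose Z W 0
    rw [zero_smul, add_zero] at h3
    exact HasFDerivAt.comp_hasDerivAt_of_eq (0 : ℝ) hL.hasFDerivAt h3 (by simp)
  exact h1.unique h2

theorem ContDiffAt.hasDerivAt_fderiv_apply {E : Type*} [NormedAddCommGroup E]
    [NormedSpace ℝ E] {f : E → ℝ} {x y : ℝ → E} {x' y' : E} {s : ℝ} (hf : ContDiffAt ℝ 2 f (x s))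
    (hx : HasDerivAt x x' s) (hy : HasDerivAt y y' s) :
    HasDerivAt (fun s => fderiv ℝ f (x s) (y s))
      (fderiv ℝ (fderiv ℝ f) (x s) x' (y s) + fderiv ℝ f (x s) y') s := by
  have h1 : DifferentiableAt ℝ (fderiv ℝ f) (x s) :=
    (hf.fderiv_right (m := 1) (by norm_num)).differentiableAt (by norm_num)
  exact (h1.hasFDerivAt.comp_hasDerivAt s hx).clm_apply hy

/-- Mean value theorem for the derivative of `L` at `Y * Yᵀ` in the direction `tangent Y V`, with `Y
= Zs + s • Δ`; it vanishes at `s = 0`. The two terms come from moving the base point and from moving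
the direction. Since `ξ` depends on `V`, each application must put all it needs into one `V`. -/
theorem exists_frob_gradAt_tangent_eq {L : Matrix (Fin n) (Fin n) ℝ → ℝ}
    {Zs Δ : Matrix (Fin n) (Fin r) ℝ}
    (hL : ∀ s ∈ Set.Icc (0 : ℝ) 1, ContDiffAt ℝ 2 L ((Zs + s • Δ) * (Zs + s • Δ)ᵀ))
    (h0 : gradAt L Zs = 0) (V : Matrix (Fin n) (Fin r) ℝ) :
    ∃ ξ ∈ Set.Icc (0 : ℝ) 1, frob (gradAt L (Zs + Δ)) (tangent (Zs + Δ) V) =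
      matHess L ((Zs + ξ • Δ) * (Zs + ξ • Δ)ᵀ) (tangent (Zs + ξ • Δ) Δ) (tangent (Zs + ξ • Δ) V) +
        frob (gradAt L (Zs + ξ • Δ)) (tangent Δ V) := by
  set X : ℝ → Matrix (Fin n) (Fin n) ℝ := fun s => (Zs + s • Δ) * (Zs + s • Δ)ᵀ
  set F : ℝ → ℝ := fun s => fderiv ℝ L (X s) (tangent (Zs + s • Δ) V)
  have hF : ∀ s ∈ Set.Icc (0 : ℝ) 1, HasDerivAt F
      (fderiv ℝ (fderiv ℝ L) (X s) (tangent (Zs + s • Δ) Δ) (tangent (Zs + s • Δ) V) +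
        fderiv ℝ L (X s) (tangent Δ V)) s := by
    intro s hs
    have h3 : HasDerivAt (fun s : ℝ => tangent (Zs + s • Δ) V) (tangent Δ V) s := by
      have e : (fun s : ℝ => tangent (Zs + s • Δ) V) =
          fun s : ℝ => tangent Zs V + s • tangent Δ V := by
        ext1 s
        rw [tangent_comm, tangent_add, tangent_smul, tangent_comm V, tangent_comm V]
      rw [e]
      have := ((hasDerivAt_id s).smul_const (tangent Δ V)).const_add (tangent Zs V)
      rwa [one_smul] at this
    exact (hL s hs).hasDerivAt_fderiv_apply (hasDerivAt_add_smul_mul_transpose Zs Δ s) h3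
  obtain ⟨ξ, hξ, h⟩ := exists_hasDerivAt_eq_slope F _ one_pos
    (fun s hs => (hF s hs).continuousAt.continuousWithinAt)
    (fun s hs => hF s ⟨hs.1.le, hs.2.le⟩)
  refine ⟨ξ, ⟨hξ.1.le, hξ.2.le⟩, ?_⟩
  have hF0 : F 0 = 0 := by
    have : matGrad L (Zs * Zsᵀ) = 0 := h0
    simp [F, X, fderiv_apply_eq_frob, this, frob]
  have hF1 : F 1 = frob (gradAt L (Zs + Δ)) (tangent (Zs + Δ) V) := by
    simp [F, X, fderiv_apply_eq_frob, gradAt]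
  rw [hF0, sub_zero, sub_zero, div_one, hF1] at h
  rw [← h, fderiv_apply_eq_frob L]
  rfl

theorem matHess_comm {f : Matrix (Fin n) (Fin m) ℝ → ℝ} {X : Matrix (Fin n) (Fin m) ℝ}
    (hf : ContDiffAt ℝ 2 f X) (A B : Matrix (Fin n) (Fin m) ℝ) :
    matHess f X A B = matHess f X B A :=
  (hf.isSymmSndFDerivAt (by simp)).eq A B

variable (f : Matrix (Fin n) (Fin m) ℝ → ℝ) (X A B C : Matrix (Fin n) (Fin m) ℝ) (c : ℝ)

theorem matHess_add_left : matHess f X (A + B) C = matHess f X A C + matHess f X B C := by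
  simp [matHess]

theorem matHess_sub_left : matHess f X (A - B) C = matHess f X A C - matHess f X B C := by
  simp [matHess]

theorem matHess_sub_right : matHess f X A (B - C) = matHess f X A B - matHess f X A C := by
  simp [matHess]

theorem matHess_smul_left : matHess f X (c • A) B = c * matHess f X A B := by
  simp [matHess]

theorem matHess_smul_right : matHess f X A (c • B) = c * matHess f X A B := by
  simp [matHess]

end Calculus

/-! ### Stability of the spectral bounds along the segment. -/

section Perturbation
variable {n r : ℕ} {Zs Δ : Matrix (Fin n) (Fin r) ℝ} {s ξ : ℝ}

theorem norm_smul_le_of_mem_Icc (hξ : ξ ∈ Set.Icc (0 : ℝ) 1) (Δ : Matrix (Fin n) (Fin r) ℝ) :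
    ‖ξ • Δ‖ ≤ ‖Δ‖ := by
  rw [norm_smul, Real.norm_of_nonneg hξ.1]
  exact mul_le_of_le_one_left (norm_nonneg _) hξ.2

theorem l2_add_smul_mulVec_le (h : ∀ v, l2 (Zs *ᵥ v) ≤ s * l2 v) (hξ : ξ ∈ Set.Icc (0 : ℝ) 1)
    (v : Fin r → ℝ) : l2 ((Zs + ξ • Δ) *ᵥ v) ≤ (s + ‖Δ‖) * l2 v := by
  rw [Matrix.add_mulVec, add_mul]
  refine (l2_add_le _ _).trans (add_le_add (h v) ((l2_mulVec_le_norm _ _).trans ?_))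
  exact mul_le_mul_of_nonneg_right (norm_smul_le_of_mem_Icc hξ Δ) (l2_nonneg v)

theorem le_l2_add_smul_mulVec (h : ∀ v, s * l2 v ≤ l2 (Zs *ᵥ v)) (hξ : ξ ∈ Set.Icc (0 : ℝ) 1)
    (v : Fin r → ℝ) : (s - ‖Δ‖) * l2 v ≤ l2 ((Zs + ξ • Δ) *ᵥ v) := by
  have h1 : Zs *ᵥ v = (Zs + ξ • Δ) *ᵥ v + (-(ξ • Δ)) *ᵥ v := by
    rw [← Matrix.add_mulVec, add_neg_cancel_right]
  have h2 := l2_add_le ((Zs + ξ • Δ) *ᵥ v) ((-(ξ • Δ)) *ᵥ v)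
  rw [← h1] at h2
  have h3 := l2_mulVec_le_norm (-(ξ • Δ)) v
  rw [norm_neg] at h3
  have h4 := mul_le_mul_of_nonneg_right (norm_smul_le_of_mem_Icc hξ Δ) (l2_nonneg v)
  have h5 := h v
  linarith

theorem norm_gram_sub_gram_le (hs : 0 ≤ s) (h : ∀ v, l2 (Zs *ᵥ v) ≤ s * l2 v)
    (hξ : ξ ∈ Set.Icc (0 : ℝ) 1) :
    ‖(Zs + ξ • Δ) * (Zs + ξ • Δ)ᵀ - Zs * Zsᵀ‖ ≤ 2 * s * ‖Δ‖ + ‖Δ‖ ^ 2 := by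
  have h1 : (Zs + ξ • Δ) * (Zs + ξ • Δ)ᵀ - Zs * Zsᵀ =
      tangent Zs (ξ • Δ) + (ξ • Δ) * (ξ • Δ)ᵀ := by
    rw [add_smul_mul_transpose, tangent_smul, Matrix.transpose_smul, Matrix.smul_mul,
      Matrix.mul_smul, smul_smul, sq]
    abel
  have h2 := norm_smul_le_of_mem_Icc hξ Δ
  rw [h1]
  refine (norm_add_le _ _).trans (add_le_add ((norm_tangent_le hs h _).trans ?_)
    ((Matrix.frobenius_norm_mul _ _).trans ?_))
  · gcongr
  · rw [Matrix.frobenius_norm_transpose, ← sq]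
    gcongr

end Perturbation

/-! ### Comparison of the restricted isometry and Lipschitz constants. -/

section Descent
variable {n r : ℕ} {L : Matrix (Fin n) (Fin n) ℝ → ℝ} {Zs Δ : Matrix (Fin n) (Fin r) ℝ}
  {D : Set (Matrix (Fin n) (Fin r) ℝ)} {α β Λ : ℝ}

theorem LocalGradLipschitz.opNorm_gradAt_le (h : LocalGradLipschitz L D Λ)
    (h0 : gradAt L Zs = 0) (hZs : Zs ∈ D) {Y : Matrix (Fin n) (Fin r) ℝ} (hY : Y ∈ D) :
    opNorm (gradAt L Y) ≤ Λ * ‖Y * Yᵀ - Zs * Zsᵀ‖ := by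
  simpa [h0] using h Y hY Zs hZs

theorem LocalGradLipschitz.mono {Λ' : ℝ} (h : LocalGradLipschitz L D Λ) (hΛ : Λ ≤ Λ') :
    LocalGradLipschitz L D Λ' := fun Z₁ h₁ Z₂ h₂ =>
  (h Z₁ h₁ Z₂ h₂).trans (mul_le_mul_of_nonneg_right hΛ (norm_nonneg _))

theorem frob_vecMulVec {m : ℕ} (a c : Fin n → ℝ) (b d : Fin m → ℝ) :
    frob (Matrix.vecMulVec a b) (Matrix.vecMulVec c d) = (a ⬝ᵥ c) * (b ⬝ᵥ d) := by
  rw [frob, Matrix.transpose_vecMulVec, Matrix.vecMulVec_mul_vecMulVec, Matrix.vecMulVec_smul,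
    Matrix.trace_smul, Matrix.trace_vecMulVec, smul_eq_mul]

/-- Testing the restricted isometry property on a rank one direction bounds its lower constant by
the Lipschitz constant of the gradient. -/
theorem LocalRIP.le_of_localGradLipschitz (hrip : LocalRIP L D α β)
    (hlip : LocalGradLipschitz L D Λ) (hΛ : 0 ≤ Λ) (hsm : SmoothOnRegion L D)
    (h0 : gradAt L Zs = 0) {δ : ℝ} (hδ : 0 < δ) (hD : ∀ Y, ‖Y - Zs‖ ≤ δ → Y ∈ D)
    (j : Fin r) (hj : Zs *ᵥ Pi.single j 1 ≠ 0) : α ≤ 5 * Λ := by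
  -- Perturb only column `j`, along itself: then `Y * Yᵀ` moves on the line spanned by `z zᵀ`, and
  -- every tangent direction involved is a multiple of it.
  set z := Zs *ᵥ Pi.single j 1 with hz
  set W := Matrix.vecMulVec z (Pi.single j (1 : ℝ)) with hW
  set T := Matrix.vecMulVec z z with hT
  set q := z ⬝ᵥ z with hq
  have hq0 : 0 < q := lt_of_le_of_ne (by rw [hq, ← l2_sq]; positivity)
    (Ne.symm fun h => hj (dotProduct_self_eq_zero.1 h))
  have hWn : ‖W‖ ^ 2 = q := by
    rw [← frob_self, hW, frob_vecMulVec]; simp [hq]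
  have hTn : ‖T‖ = q := by
    refine (sq_eq_sq₀ (norm_nonneg _) hq0.le).1 ?_
    rw [← frob_self, hT, frob_vecMulVec, sq]
  have hWW : W * Wᵀ = T := by
    rw [hW, Matrix.transpose_vecMulVec, Matrix.vecMulVec_mul_vecMulVec]; simp [hT]
  have htZ : tangent Zs W = (2 : ℝ) • T := by
    rw [tangent, ← Matrix.transpose_transpose (W * Zsᵀ), Matrix.transpose_mul,
      Matrix.transpose_transpose, hW, Matrix.transpose_vecMulVec, Matrix.mul_vecMulVec, ← hz, ← hT,
      two_smul, hT, Matrix.transpose_vecMulVec]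
  have htW : tangent W W = (2 : ℝ) • T := by rw [tangent, hWW, two_smul]
  have htY (c : ℝ) : tangent (Zs + c • W) W = (2 * (1 + c)) • T := by
    rw [tangent_comm, tangent_add, tangent_comm, tangent_smul, htZ, htW, smul_smul, ← add_smul]
    congr 1; ring
  have hWpos : 0 < ‖W‖ := by
    by_contra h
    have : ‖W‖ = 0 := le_antisymm (not_lt.1 h) (norm_nonneg _)
    rw [this] at hWn; norm_num at hWn; exact hq0.ne hWn
  -- The second bound keeps the segment in `D`; `s ≤ 1` absorbs the quadratic term in `2 c + c² ≤ 3
  -- s`.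
  set s := min 1 (δ / ‖W‖) with hs
  have hs0 : 0 < s := lt_min one_pos (by positivity)
  have hs1 : s ≤ 1 := min_le_left _ _
  have hseg : ∀ c ∈ Set.Icc (0 : ℝ) s, Zs + c • W ∈ D := fun c hc => by
    apply hD
    rw [add_sub_cancel_left, norm_smul, Real.norm_of_nonneg hc.1, ← le_div_iff₀ hWpos]
    exact hc.2.trans (min_le_right _ _)
  have hG : ∀ c ∈ Set.Icc (0 : ℝ) s, |frob (gradAt L (Zs + c • W)) T| ≤ Λ * (3 * s * q) * q := by
    intro c hc
    have h1 := hlip.opNorm_gradAt_le h0 (by simpa using hseg 0 ⟨le_rfl, hs0.le⟩) (hseg c hc)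
    have h2 : ‖(Zs + c • W) * (Zs + c • W)ᵀ - Zs * Zsᵀ‖ ≤ 3 * s * q := by
      have e : (Zs + c • W) * (Zs + c • W)ᵀ - Zs * Zsᵀ = (2 * c + c ^ 2) • T := by
        rw [add_smul_mul_transpose, htZ, hWW, smul_smul, add_assoc, add_sub_cancel_left, ← add_smul]
        congr 1; ring
      have hc0 := hc.1
      have hc1 := hc.2
      rw [e, norm_smul, hTn, Real.norm_of_nonneg (by positivity)]
      gcongr
      nlinarith
    have h3 := abs_frob_tangent_le (gradAt L (Zs + c • W)) W W
    rw [htW, frob_smul_right, abs_mul, abs_two, mul_assoc, mul_assoc, ← mul_assoc _ ‖W‖, mul_assoc,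
      ← sq, hWn] at h3
    calc _ ≤ opNorm (gradAt L (Zs + c • W)) * q := by linarith
      _ ≤ (Λ * (3 * s * q)) * q := by
        gcongr
        exact h1.trans (mul_le_mul_of_nonneg_left h2 hΛ)
  obtain ⟨ξ, hξ, h⟩ := exists_frob_gradAt_tangent_eq (L := L) (Zs := Zs) (Δ := s • W)
    (fun c hc => hsm _ (by
      rw [smul_smul]
      exact hseg _ ⟨mul_nonneg hc.1 hs0.le, mul_le_of_le_one_left hs0.le hc.2⟩)) h0 (s • W)
  have hξs : ξ * s ∈ Set.Icc (0 : ℝ) s :=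
    ⟨mul_nonneg hξ.1 hs0.le, mul_le_of_le_one_left hs0.le hξ.2⟩
  have h4 := (hrip.2.2 (Zs + ξ • s • W) (by rw [smul_smul]; exact hseg _ hξs) (s • W)).1
  rw [tangent_smul, tangent_smul, tangent_smul, tangent_comm (s • W), tangent_smul, smul_smul ξ s W, htY, htY,
    htW] at h
  rw [tangent_smul, smul_smul ξ s W, htY] at h4
  simp only [frob_smul_right] at h
  rw [norm_smul, norm_smul, hTn, Real.norm_of_nonneg hs0.le,
    Real.norm_of_nonneg (by linarith [hξs.1])] at h4
  have h5 := (le_abs_self _).trans (hG s ⟨hs0.le, le_rfl⟩)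
  have h6 := (neg_le_abs _).trans (hG (ξ * s) hξs)
  have h7 : α * (s * (2 * q)) ^ 2 ≤ α * (s * (2 * (1 + ξ * s) * q)) ^ 2 := by
    have := hrip.1
    have := hξs.1
    gcongr
    linarith
  have h8 : s * (2 * (1 + s) * frob (gradAt L (Zs + s • W)) T) ≤
      s * (2 * (1 + s) * (Λ * (3 * s * q) * q)) := by gcongr
  have h9 : s * (s * (2 * -frob (gradAt L (Zs + (ξ * s) • W)) T)) ≤
      s * (s * (2 * (Λ * (3 * s * q) * q))) := by gcongr
  -- The two gradient terms add up to `(6 + 12 s) Λ (s q)²`, at most `18 Λ (s q)²` since `s ≤ 1`.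
  have h10 : (4 * (s * q) ^ 2) * α ≤ (4 * (s * q) ^ 2) * (5 * Λ) := by
    have : 0 ≤ Λ * (s * q) ^ 2 * (1 - s) := by
      have : 0 ≤ 1 - s := by linarith
      positivity
    nlinarith
  exact le_of_mul_le_mul_left h10 (by positivity)

end Descent

/-! ### One-step contraction in Frobenius norm. -/

/-- The local conditions along the segment from `Zs` to an aligned iterate `Zs + Δ` under which one
gradient step contracts. -/
structure StepConditions {n r : ℕ} (L : Matrix (Fin n) (Fin n) ℝ → ℝ)
    (D : Set (Matrix (Fin n) (Fin r) ℝ)) (Zs Δ : Matrix (Fin n) (Fin r) ℝ)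
    (α β sr s₁ γ : ℝ) : Prop where
  smooth : SmoothOnRegion L D
  gradAt_eq_zero : gradAt L Zs = 0
  rip : LocalRIP L D α β
  segment_mem : ∀ ξ ∈ Set.Icc (0 : ℝ) 1, Zs + ξ • Δ ∈ D
  sr_pos : 0 < sr
  sr_le : sr ≤ s₁
  upper : ∀ v, l2 (Zs *ᵥ v) ≤ s₁ * l2 v
  lower : ∀ v, sr * l2 v ≤ l2 (Zs *ᵥ v)
  symm : (Zsᵀ * Δ)ᵀ = Zsᵀ * Δ
  norm_le : ‖Δ‖ ≤ sr / 200
  opNorm_le : ∀ ξ ∈ Set.Icc (0 : ℝ) 1, opNorm (gradAt L (Zs + ξ • Δ)) ≤ α * sr ^ 2 / 300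
  step_eq : γ * (α + β) * s₁ ^ 2 = 1 / 10

namespace StepConditions
variable {n r : ℕ} {L : Matrix (Fin n) (Fin n) ℝ → ℝ} {D : Set (Matrix (Fin n) (Fin r) ℝ)}
  {Zs Δ : Matrix (Fin n) (Fin r) ℝ} {α β sr s₁ γ : ℝ}

theorem s₁_pos (h : StepConditions L D Zs Δ α β sr s₁ γ) : 0 < s₁ := h.sr_pos.trans_le h.sr_le

theorem β_pos (h : StepConditions L D Zs Δ α β sr s₁ γ) : 0 < β := h.rip.1.trans_le h.rip.2.1

theorem γ_pos (h : StepConditions L D Zs Δ α β sr s₁ γ) : 0 < γ := by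
  have h1 := h.step_eq
  have h2 := h.rip.1
  have h3 := h.β_pos
  have h4 := h.s₁_pos
  by_contra hγ
  have : γ * ((α + β) * s₁ ^ 2) ≤ 0 :=
    mul_nonpos_of_nonpos_of_nonneg (not_lt.1 hγ) (by positivity)
  linarith

theorem γ_mul_β_le (h : StepConditions L D Zs Δ α β sr s₁ γ) : γ * (β * s₁ ^ 2) ≤ 1 / 10 := by
  have h1 := h.step_eq
  have h2 := mul_nonneg (mul_pos h.γ_pos h.rip.1).le (sq_nonneg s₁)
  linarith

theorem sr_sq_le (h : StepConditions L D Zs Δ α β sr s₁ γ) : sr ^ 2 ≤ s₁ ^ 2 :=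
  pow_le_pow_left₀ h.sr_pos.le h.sr_le 2

theorem γ_mul_α_le (h : StepConditions L D Zs Δ α β sr s₁ γ) : γ * (α * sr ^ 2) ≤ 1 / 20 := by
  have h1 := h.step_eq
  have h2 := mul_le_mul_of_nonneg_left h.rip.2.1 (mul_nonneg h.γ_pos.le (sq_nonneg s₁))
  have h3 := mul_le_mul_of_nonneg_left h.sr_sq_le (mul_pos h.γ_pos h.rip.1).le
  linarith

theorem contDiffAt (h : StepConditions L D Zs Δ α β sr s₁ γ) :
    ∀ ξ ∈ Set.Icc (0 : ℝ) 1, ContDiffAt ℝ 2 L ((Zs + ξ • Δ) * (Zs + ξ • Δ)ᵀ) :=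
  fun ξ hξ => h.smooth _ (h.segment_mem ξ hξ)

theorem norm_tangent_sq_le (h : StepConditions L D Zs Δ α β sr s₁ γ) {ξ : ℝ}
    (hξ : ξ ∈ Set.Icc (0 : ℝ) 1) (W : Matrix (Fin n) (Fin r) ℝ) :
    ‖tangent (Zs + ξ • Δ) W‖ ^ 2 ≤ 41 / 10 * s₁ ^ 2 * ‖W‖ ^ 2 := by
  have hs := h.s₁_pos
  have h1 := norm_tangent_le (add_nonneg hs.le (norm_nonneg Δ))
    (l2_add_smul_mulVec_le h.upper hξ) W
  have h2 := h.norm_le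
  have h3 := h.sr_le
  calc _ ≤ (2 * (s₁ + ‖Δ‖) * ‖W‖) ^ 2 := by gcongr
    _ = (2 * (s₁ + ‖Δ‖)) ^ 2 * ‖W‖ ^ 2 := by ring
    _ ≤ _ := by
      gcongr
      have : 2 * (s₁ + ‖Δ‖) ≤ 2 * (s₁ * (1 + 1 / 200)) := by linarith
      have h4 := pow_le_pow_left₀ (by positivity) this 2
      nlinarith [sq_nonneg s₁]

theorem le_norm_tangent_sq_segment (h : StepConditions L D Zs Δ α β sr s₁ γ) {ξ : ℝ}
    (hξ : ξ ∈ Set.Icc (0 : ℝ) 1) {W : Matrix (Fin n) (Fin r) ℝ}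
    (hW : 0 ≤ frob (Wᵀ * (Zs + ξ • Δ)) ((Zs + ξ • Δ)ᵀ * W)) :
    19 / 10 * sr ^ 2 * ‖W‖ ^ 2 ≤ ‖tangent (Zs + ξ • Δ) W‖ ^ 2 := by
  have hs := h.sr_pos
  have h2 := h.norm_le
  refine le_trans ?_ (le_norm_tangent_sq (by linarith) (le_l2_add_smul_mulVec h.lower hξ) hW)
  refine mul_le_mul_of_nonneg_right ?_ (sq_nonneg _)
  have h3 : sr * (199 / 200) ≤ sr - ‖Δ‖ := by linarith
  have h4 := pow_le_pow_left₀ (by positivity) h3 2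
  nlinarith [sq_nonneg sr]

/-- One gradient step contracts the Frobenius distance. -/
theorem norm_sub_smul_sq_le (h : StepConditions L D Zs Δ α β sr s₁ γ)
    {W : Matrix (Fin n) (Fin r) ℝ}
    (hW : ∀ V, frob W V = frob (gradAt L (Zs + Δ)) (tangent (Zs + Δ) V)) :
    ‖Δ - γ • W‖ ^ 2 ≤ (1 - γ * (α * sr ^ 2)) * ‖Δ‖ ^ 2 := by
  have hγ := h.γ_pos
  have hα := h.rip.1
  have hβ := h.β_pos
  have hsr := h.sr_pos
  -- This combination of `Δ` and `W` yields the descent term and the squared gradient at one common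
  -- intermediate point.
  obtain ⟨ξ, hξ, heq⟩ := exists_frob_gradAt_tangent_eq h.contDiffAt h.gradAt_eq_zero
    ((2 : ℝ) • Δ - (2 * γ) • W)
  set Y := Zs + ξ • Δ with hY
  set A := matHess L (Y * Yᵀ) (tangent Y Δ) (tangent Y Δ)
  set B := matHess L (Y * Yᵀ) (tangent Y Δ) (tangent Y W) with hB
  set C := matHess L (Y * Yᵀ) (tangent Y W) (tangent Y W)
  rw [← hW, tangent_sub, tangent_smul, tangent_smul, matHess_sub_right, matHess_smul_right,
    matHess_smul_right, frob_sub_right, frob_smul_right, frob_smul_right, frob_self] at heq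
  have hrem : |frob (gradAt L Y) (tangent Δ ((2 : ℝ) • Δ - (2 * γ) • W))| ≤
      4 * (α * sr ^ 2 / 300) * ‖Δ‖ * (‖Δ‖ + γ * ‖W‖) := by
    refine (abs_frob_tangent_le _ _ _).trans ?_
    have h1 : ‖(2 : ℝ) • Δ - (2 * γ) • W‖ ≤ 2 * (‖Δ‖ + γ * ‖W‖) := by
      refine (norm_sub_le _ _).trans (le_of_eq ?_)
      rw [norm_smul, norm_smul, Real.norm_of_nonneg (by positivity),
        Real.norm_of_nonneg (by positivity)]
      ring
    calc _ ≤ 2 * (α * sr ^ 2 / 300) * ‖Δ‖ * (2 * (‖Δ‖ + γ * ‖W‖)) := by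
          gcongr
          exact h.opNorm_le ξ hξ
      _ = _ := by ring
  -- Positivity of the Hessian on `tangent Y (Δ - γ • W)` replaces a Cauchy–Schwarz bound for the
  -- mixed term `B`.
  have hpsd : 0 ≤ A - 2 * γ * B + γ ^ 2 * C := by
    have h1 := (h.rip.2.2 Y (h.segment_mem ξ hξ) (Δ - γ • W)).1
    have h2 : 0 ≤ α * ‖tangent Y (Δ - γ • W)‖ ^ 2 := by positivity
    have h3 := h2.trans h1
    rw [tangent_sub, tangent_smul, matHess_sub_right, matHess_sub_left, matHess_sub_left,
      matHess_smul_right, matHess_smul_right, matHess_smul_left, matHess_smul_left,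
      matHess_comm (h.contDiffAt ξ hξ) (tangent Y W) (tangent Y Δ), ← hB] at h3
    linarith
  have hA : 19 / 10 * (α * sr ^ 2) * ‖Δ‖ ^ 2 ≤ A := by
    have h1 := (h.rip.2.2 Y (h.segment_mem ξ hξ) Δ).1
    have h2 : 19 / 10 * sr ^ 2 * ‖Δ‖ ^ 2 ≤ ‖tangent Y Δ‖ ^ 2 := by
      refine h.le_norm_tangent_sq_segment hξ (frob_transpose_mul_nonneg_of_symm ?_)
      rw [Matrix.transpose_add, Matrix.add_mul, Matrix.transpose_add, h.symm, Matrix.transpose_smul,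
        Matrix.smul_mul, Matrix.transpose_smul, Matrix.transpose_mul, Matrix.transpose_transpose]
    have h3 := mul_le_mul_of_nonneg_left h2 hα.le
    linarith
  have hC : γ ^ 2 * C ≤ 41 / 100 * (γ * ‖W‖ ^ 2) := by
    have h1 := (h.rip.2.2 Y (h.segment_mem ξ hξ) W).2
    have h2 := mul_le_mul_of_nonneg_left (h.norm_tangent_sq_le hξ W) hβ.le
    have h3 := mul_le_mul_of_nonneg_left (h1.trans h2) (sq_nonneg γ)
    have h4 := mul_le_mul_of_nonneg_right h.γ_mul_β_le
      (mul_nonneg hγ.le (sq_nonneg ‖W‖))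
    nlinarith
  rw [norm_sub_sq_frob, frob_smul_right, norm_smul, Real.norm_of_nonneg hγ.le, frob_comm Δ W]
  have hu := h.γ_mul_α_le
  set u := α * sr ^ 2
  have hu0 : 0 < u := by positivity
  have h5 := (abs_le.1 hrem).1
  set e := frob (gradAt L Y) (tangent Δ ((2 : ℝ) • Δ - (2 * γ) • W))
  set d := ‖Δ‖
  set w := ‖W‖
  set p := frob W Δ
  -- The gain is `1.9 u d² + 0.59 γ w²`; the remainder's cross term `γ u d w` is split by the square
  -- in `h7` and absorbed using `γ u ≤ 1/20`.
  have h6 : 2 * p - γ * w ^ 2 ≥ u * d ^ 2 := by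
    have h7 : 0 ≤ γ * (w - u * d) ^ 2 := by positivity
    have h8 : γ * u * (u * d ^ 2) ≤ 1 / 20 * (u * d ^ 2) := by gcongr
    have h9 : 0 ≤ u * d ^ 2 := by positivity
    have h10 : 0 ≤ γ * w ^ 2 := by positivity
    nlinarith
  nlinarith [mul_le_mul_of_nonneg_left h6 hγ.le]

end StepConditions

/-! ### One-step contraction of each row. -/

namespace StepConditions
variable {n r : ℕ} {L : Matrix (Fin n) (Fin n) ℝ → ℝ} {D : Set (Matrix (Fin n) (Fin r) ℝ)}
  {Zs Δ : Matrix (Fin n) (Fin r) ℝ} {α β sr s₁ γ : ℝ}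

theorem frob_tangent_of_symm {G : Matrix (Fin n) (Fin n) ℝ} (hG : Gᵀ = G)
    (A B : Matrix (Fin n) (Fin r) ℝ) : frob G (tangent A B) = 2 * frob (G * A) B := by
  have h1 : frob G (B * Aᵀ) = frob (G * A) B := by
    rw [frob_comm, frob_mul_eq_right, Matrix.transpose_transpose, frob_comm]
  have h2 : frob G (A * Bᵀ) = frob G (B * Aᵀ) := by
    rw [← frob_transpose, hG, Matrix.transpose_mul, Matrix.transpose_transpose]
  rw [tangent, frob_add_right, h2, h1]; ring

theorem twoInfNorm_gram_sub_gram_le (h : StepConditions L D Zs Δ α β sr s₁ γ) {ξ : ℝ}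
    (hξ : ξ ∈ Set.Icc (0 : ℝ) 1) {b : ℝ} (hb : twoInfNorm Δ ≤ b) :
    twoInfNorm ((Zs + ξ • Δ) * (Zs + ξ • Δ)ᵀ - Zs * Zsᵀ) ≤
      b * (s₁ + ‖Δ‖) + twoInfNorm Zs * ‖Δ‖ := by
  have hs := h.s₁_pos
  have hb0 := (twoInfNorm_nonneg Δ).trans hb
  have hm := twoInfNorm_nonneg Zs
  have e : (Zs + ξ • Δ) * (Zs + ξ • Δ)ᵀ - Zs * Zsᵀ =
      (ξ • Δ) * (Zs + ξ • Δ)ᵀ + Zs * (ξ • Δ)ᵀ := by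
    rw [Matrix.add_mul, Matrix.transpose_add, Matrix.mul_add Zs]; abel
  rw [e]
  refine (twoInfNorm_add_le _ _).trans (add_le_add ?_ ?_)
  · refine twoInfNorm_le (by positivity) fun i => ?_
    rw [row_mul_transpose]
    refine (l2_add_smul_mulVec_le h.upper hξ _).trans ?_
    rw [mul_comm]
    gcongr
    exact (l2_row_le_twoInfNorm _ i).trans ((twoInfNorm_smul_le hξ.1 _).trans
      ((mul_le_of_le_one_left (twoInfNorm_nonneg _) hξ.2).trans hb))
  · refine twoInfNorm_le (by positivity) fun i => ?_
    rw [row_mul_transpose]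
    refine (l2_mulVec_le_norm _ _).trans ?_
    rw [mul_comm]
    gcongr
    · exact l2_row_le_twoInfNorm _ i
    · exact norm_smul_le_of_mem_Icc hξ Δ

/-- The part of the gradient step acting within one row contracts. -/
theorem dotProduct_sub_matHess_row_le (h : StepConditions L D Zs Δ α β sr s₁ γ) {ξ : ℝ}
    (hξ : ξ ∈ Set.Icc (0 : ℝ) 1) (i : Fin n) (u v : Fin r → ℝ) :
    u ⬝ᵥ v - γ * matHess L ((Zs + ξ • Δ) * (Zs + ξ • Δ)ᵀ)
      (tangent (Zs + ξ • Δ) (Matrix.vecMulVec (Pi.single i 1) u))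
      (tangent (Zs + ξ • Δ) (Matrix.vecMulVec (Pi.single i 1) v)) ≤
    (1 - 19 / 10 * (γ * (α * sr ^ 2))) * (l2 u * l2 v) := by
  have hcomm := matHess_comm (h.contDiffAt ξ hξ)
  set Y := Zs + ξ • Δ with hY
  set P : (Fin r → ℝ) → Matrix (Fin n) (Fin n) ℝ :=
    fun u => tangent Y (Matrix.vecMulVec (Pi.single i 1) u)
  -- `S` is a symmetric form with `0 ≤ S u u`, because `4.1 γ β s₁² ≤ 0.41`, and with `S u u` at
  -- most the contraction factor times `l2 u ^ 2`. Positivity on `l2 v • u - l2 u • v` then bounds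
  -- `S u v`.
  set S : (Fin r → ℝ) → (Fin r → ℝ) → ℝ :=
    fun u v => u ⬝ᵥ v - γ * matHess L (Y * Yᵀ) (P u) (P v) with hS
  have hγ := h.γ_pos
  have hlow (u : Fin r → ℝ) : 0 ≤ S u u := by
    have h1 := (h.rip.2.2 Y (h.segment_mem ξ hξ) (Matrix.vecMulVec (Pi.single i 1) u)).2
    have h2 := h.norm_tangent_sq_le hξ (Matrix.vecMulVec (Pi.single i 1) u)
    rw [norm_vecMulVec_single] at h2
    have h3 := mul_le_mul_of_nonneg_left
      (h1.trans (mul_le_mul_of_nonneg_left h2 h.β_pos.le)) hγ.le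
    have h4 := mul_le_mul_of_nonneg_right h.γ_mul_β_le (sq_nonneg (l2 u))
    have h5 := sq_nonneg (l2 u)
    simp only [hS, P, ← l2_sq]
    linarith
  have hupp (u : Fin r → ℝ) : S u u ≤ (1 - 19 / 10 * (γ * (α * sr ^ 2))) * l2 u ^ 2 := by
    have h1 := (h.rip.2.2 Y (h.segment_mem ξ hξ) (Matrix.vecMulVec (Pi.single i 1) u)).1
    have h2 := h.le_norm_tangent_sq_segment hξ (frob_transpose_mul_nonneg_of_row Y i u)
    rw [norm_vecMulVec_single] at h2
    have h3 := mul_le_mul_of_nonneg_left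
      ((mul_le_mul_of_nonneg_left h2 h.rip.1.le).trans h1) hγ.le
    simp only [hS, P, ← l2_sq]
    linarith
  have hP0 : P 0 = 0 := by
    have : Matrix.vecMulVec (Pi.single i (1 : ℝ)) (0 : Fin r → ℝ) = 0 := by
      ext; simp [Matrix.vecMulVec_apply]
    simp only [P, this]
    simp [tangent]
  change S u v ≤ _
  rcases (l2_nonneg u).eq_or_lt with hu | hu
  · have hu0 : u = 0 := by
      have := l2_sq u
      rw [← hu] at this
      exact dotProduct_self_eq_zero.1 (by rw [← this]; norm_num)
    rw [← hu, hu0]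
    simp [hS, hP0, matHess]
  rcases (l2_nonneg v).eq_or_lt with hv | hv
  · have hv0 : v = 0 := by
      have := l2_sq v
      rw [← hv] at this
      exact dotProduct_self_eq_zero.1 (by rw [← this]; norm_num)
    rw [← hv, hv0]
    simp [hS, hP0, matHess]
  have hexp : S (l2 v • u - l2 u • v) (l2 v • u - l2 u • v) =
      l2 v ^ 2 * S u u - 2 * (l2 u * l2 v) * S u v + l2 u ^ 2 * S v v := by
    have hP : P (l2 v • u - l2 u • v) = l2 v • P u - l2 u • P v := by
      simp only [P, Matrix.vecMulVec_sub, Matrix.vecMulVec_smul, tangent_sub, tangent_smul]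
    simp only [hS, hP, matHess_sub_left, matHess_sub_right, matHess_smul_left, matHess_smul_right,
      sub_dotProduct, dotProduct_sub, smul_dotProduct, dotProduct_smul, smul_eq_mul,
      hcomm (P v) (P u), dotProduct_comm v u]
    ring
  have h1 := hlow (l2 v • u - l2 u • v)
  rw [hexp] at h1
  have h2 := mul_le_mul_of_nonneg_left (hupp u) (sq_nonneg (l2 v))
  have h3 := mul_le_mul_of_nonneg_left (hupp v) (sq_nonneg (l2 u))
  have h4 : (2 * (l2 u * l2 v)) * S u v ≤
      (2 * (l2 u * l2 v)) * ((1 - 19 / 10 * (γ * (α * sr ^ 2))) * (l2 u * l2 v)) := by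
    linarith
  exact le_of_mul_le_mul_left h4 (by positivity)

/-- One gradient step contracts the Euclidean norm of every row. -/
theorem l2_row_sub_smul_le (h : StepConditions L D Zs Δ α β sr s₁ γ)
    {W : Matrix (Fin n) (Fin r) ℝ}
    (hW : ∀ V, frob W V = frob (gradAt L (Zs + Δ)) (tangent (Zs + Δ) V))
    (hsymm : ∀ Y ∈ D, (gradAt L Y)ᵀ = gradAt L Y) (hrow : RowHessianBound L D β)
    {Λ b : ℝ} (hΛ : 0 ≤ Λ) (hlip : RowGradLipschitz L D Λ) (hb : twoInfNorm Δ ≤ b)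
    (hcross : β * (twoInfNorm Zs + b) * ((s₁ + ‖Δ‖) * ‖Δ‖) ≤ α * sr ^ 2 * b / 100)
    (hrem : 2 * (Λ * (b * (s₁ + ‖Δ‖) + twoInfNorm Zs * ‖Δ‖)) * ‖Δ‖ ≤ α * sr ^ 2 * b / 100)
    (i : Fin n) :
    l2 ((Δ - γ • W) i) ≤ (1 - 18 / 10 * (γ * (α * sr ^ 2))) * b := by
  have hγ := h.γ_pos
  have hα := h.rip.1
  have hβ := h.β_pos
  have hs := h.s₁_pos
  have hb0 := (twoInfNorm_nonneg Δ).trans hb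
  set y := (Δ - γ • W) i with hy
  -- Testing against the updated row `y` itself turns the identity into one for `l2 y ^ 2`, from
  -- which one factor `l2 y` is finally cancelled.
  set V : Matrix (Fin n) (Fin r) ℝ := Matrix.vecMulVec (Pi.single i 1) y with hV
  set U : Matrix (Fin n) (Fin r) ℝ := Matrix.vecMulVec (Pi.single i 1) (Δ i) with hU
  obtain ⟨ξ, hξ, heq⟩ := exists_frob_gradAt_tangent_eq h.contDiffAt h.gradAt_eq_zero V
  have hmem := h.segment_mem ξ hξ
  have hrowmain := h.dotProduct_sub_matHess_row_le hξ i (Δ i) y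
  have hnormY (v) := l2_add_smul_mulVec_le (Δ := Δ) h.upper hξ v
  have hrow2 := h.twoInfNorm_gram_sub_gram_le hξ hb
  have hYi : l2 ((Zs + ξ • Δ) i) ≤ twoInfNorm Zs + b :=
    (l2_row_le_twoInfNorm _ i).trans ((twoInfNorm_add_le _ _).trans (add_le_add le_rfl
      ((twoInfNorm_smul_le hξ.1 _).trans
        ((mul_le_of_le_one_left (twoInfNorm_nonneg _) hξ.2).trans hb))))
  have hhess := hrow _ hmem i y (Δ - U) (by
    ext j; simp [hU, Matrix.vecMulVec_apply])
  have hcomm := matHess_comm (h.contDiffAt ξ hξ)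
  have hZs0 : Zs ∈ D := by simpa using h.segment_mem 0 ⟨le_rfl, zero_le_one⟩
  have hlipY := hlip _ hmem _ hZs0
  rw [h.gradAt_eq_zero, sub_zero] at hlipY
  have hsymmY := hsymm _ hmem
  set Y := Zs + ξ • Δ with hY
  have hΔ' : ‖Δ - U‖ ≤ ‖Δ‖ := by
    refine le_of_sq_le_sq ?_ (norm_nonneg _)
    rw [norm_sub_sq_frob, hU, frob_vecMulVec_single, norm_vecMulVec_single, l2_sq]
    have := sq_nonneg (l2 (Δ i))
    rw [l2_sq] at this
    linarith
  have hcrossb : |matHess L (Y * Yᵀ) (tangent Y (Δ - U)) (tangent Y V)| ≤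
      α * sr ^ 2 * b / 100 * l2 y := by
    rw [hcomm]
    refine hhess.trans ?_
    have hop : opNorm Y ≤ s₁ + ‖Δ‖ := _root_.opNorm_le (by positivity) hnormY
    have := twoInfNorm_nonneg Zs
    calc _ ≤ β * ((twoInfNorm Zs + b) * l2 y) * ((s₁ + ‖Δ‖) * ‖Δ‖) := by
          have := l2_nonneg y
          have := opNorm_nonneg Y
          change β * (l2 (Y i) * l2 y) * _ ≤ _
          gcongr
      _ = β * (twoInfNorm Zs + b) * ((s₁ + ‖Δ‖) * ‖Δ‖) * l2 y := by ring
      _ ≤ _ := mul_le_mul_of_nonneg_right hcross (l2_nonneg y)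
  have hremb : |frob (gradAt L Y) (tangent Δ V)| ≤ α * sr ^ 2 * b / 100 * l2 y := by
    rw [frob_tangent_of_symm hsymmY, hV, frob_vecMulVec_single, abs_mul, abs_two]
    have h1 : l2 ((gradAt L Y * Δ) i) ≤ ‖Δ‖ * twoInfNorm (gradAt L Y) := by
      rw [← Matrix.transpose_transpose Δ, row_mul_transpose, Matrix.transpose_transpose]
      refine (l2_mulVec_le_norm _ _).trans ?_
      rw [Matrix.frobenius_norm_transpose]
      gcongr
      exact l2_row_le_twoInfNorm _ i
    have h2 := hlipY.trans (mul_le_mul_of_nonneg_left hrow2 hΛ)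
    have hy0 := l2_nonneg y
    calc _ ≤ 2 * (l2 ((gradAt L Y * Δ) i) * l2 y) := by gcongr; exact abs_dotProduct_le _ _
      _ ≤ 2 * (‖Δ‖ * (Λ * (b * (s₁ + ‖Δ‖) + twoInfNorm Zs * ‖Δ‖)) * l2 y) := by
        gcongr
        exact h1.trans (by gcongr)
      _ = (2 * (Λ * (b * (s₁ + ‖Δ‖) + twoInfNorm Zs * ‖Δ‖)) * ‖Δ‖) * l2 y := by ring
      _ ≤ _ := by gcongr
  -- `U` is row `i` of `Δ`. Its part contracts by restricted isometry; `Δ - U` vanishes in row `i`,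
  -- as the row-wise Hessian bound requires.
  have hsplit : matHess L (Y * Yᵀ) (tangent Y Δ) (tangent Y V) =
      matHess L (Y * Yᵀ) (tangent Y U) (tangent Y V) +
        matHess L (Y * Yᵀ) (tangent Y (Δ - U)) (tangent Y V) := by
    rw [← matHess_add_left, ← tangent_add, add_sub_cancel]
  have hyy : l2 y ^ 2 = Δ i ⬝ᵥ y - γ * frob W V := by
    have e : y = Δ i - γ • W i := rfl
    rw [l2_sq, hV, frob_vecMulVec_single]
    nth_rw 1 [e]
    rw [sub_dotProduct, smul_dotProduct, smul_eq_mul]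
  rw [hW, heq, hsplit] at hyy
  have h1 := mul_le_mul_of_nonneg_left ((neg_le_abs _).trans hcrossb) hγ.le
  have h2 := mul_le_mul_of_nonneg_left ((neg_le_abs _).trans hremb) hγ.le
  have hx := h.γ_mul_α_le
  have h3 : (1 - 19 / 10 * (γ * (α * sr ^ 2))) * (l2 (Δ i) * l2 y) ≤
      (1 - 19 / 10 * (γ * (α * sr ^ 2))) * (b * l2 y) := by
    have := l2_nonneg y
    gcongr
    · linarith
    · exact (l2_row_le_twoInfNorm Δ i).trans hb
  have hx0 : 0 ≤ γ * (α * sr ^ 2) := by positivity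
  have h4 : l2 y * l2 y ≤ ((1 - 18 / 10 * (γ * (α * sr ^ 2))) * b) * l2 y := by
    have : 0 ≤ γ * (α * sr ^ 2) * (b * l2 y) := mul_nonneg hx0 (mul_nonneg hb0 (l2_nonneg y))
    rw [← sq]
    linarith
  rcases (l2_nonneg y).eq_or_lt with h0 | h0
  · rw [← h0]
    exact mul_nonneg (by linarith) hb0
  · exact le_of_mul_le_mul_right h4 h0

end StepConditions

/-! ### Size of the realignment, and sufficient local conditions. -/

namespace StepConditions
variable {n r : ℕ} {L : Matrix (Fin n) (Fin n) ℝ → ℝ} {D : Set (Matrix (Fin n) (Fin r) ℝ)}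
  {Zs Δ : Matrix (Fin n) (Fin r) ℝ} {α β sr s₁ γ : ℝ}

/-- The optimal realignment after a gradient step is close to the identity, to second order. -/
theorem mul_norm_sub_one_le (h : StepConditions L D Zs Δ α β sr s₁ γ)
    {W : Matrix (Fin n) (Fin r) ℝ}
    (hW : ∀ V, frob W V = frob (gradAt L (Zs + Δ)) (tangent (Zs + Δ) V))
    (hsymm : (gradAt L (Zs + Δ))ᵀ = gradAt L (Zs + Δ))
    {R : Matrix (Fin r) (Fin r) ℝ} (hR : IsProcrustes (Zs + (Δ - γ • W)) Zs R) :
    9 / 10 * sr ^ 2 * ‖R - 1‖ ≤ 4 * γ * s₁ * opNorm (gradAt L (Zs + Δ)) * ‖Δ‖ := by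
  set G := gradAt L (Zs + Δ) with hG
  have hγ := h.γ_pos
  have hsr := h.sr_pos
  have hα := h.rip.1
  have hW' : W = (2 : ℝ) • (G * (Zs + Δ)) := frob_ext fun V => by
    rw [hW, frob_tangent_of_symm hsymm, frob_smul_left]
  have hd : ‖Δ - γ • W‖ ≤ sr / 200 := by
    refine le_trans (le_of_sq_le_sq ((h.norm_sub_smul_sq_le hW).trans ?_) (norm_nonneg _)) h.norm_le
    refine mul_le_of_le_one_left (sq_nonneg _) ?_
    have : 0 ≤ γ * (α * sr ^ 2) := by positivity
    linarith
  set N := Zsᵀ * (Zs + (Δ - γ • W)) with hN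
  have hquad (v : Fin r → ℝ) : 9 / 10 * sr ^ 2 * l2 v ^ 2 ≤ v ⬝ᵥ (N *ᵥ v) := by
    refine le_trans ?_ (le_dotProduct_transpose_mul_mulVec (d := sr / 200) h.lower
      (by rwa [add_sub_cancel_left]) (by linarith) v)
    refine mul_le_mul_of_nonneg_right ?_ (sq_nonneg _)
    nlinarith [sq_nonneg sr]
  refine (norm_one_sub_le_of_trace_le hquad hR.1
    (trace_transpose_mul_le_of_isProcrustes hR)).trans ?_
  set K := Zsᵀ * (G * Δ) with hK
  -- `Zsᵀ * Zs`, `Zsᵀ * Δ` and `Zsᵀ * G * Zs` are symmetric and cancel; what is left carries both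
  -- `G` and `Δ`.
  have hNK : N - Nᵀ = (2 * γ) • (Kᵀ - K) := by
    have e1 : N = Zsᵀ * Zs + Zsᵀ * Δ - (2 * γ) • (Zsᵀ * (G * Zs)) - (2 * γ) • K := by
      rw [hN, hW', hK]
      simp only [Matrix.mul_add, Matrix.mul_sub, Matrix.mul_smul, smul_add, smul_smul]
      rw [mul_comm γ 2]
      abel
    have e2 : (Zsᵀ * (G * Zs))ᵀ = Zsᵀ * (G * Zs) := by
      rw [Matrix.transpose_mul, Matrix.transpose_mul, hsymm, Matrix.transpose_transpose,
        Matrix.mul_assoc]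
    have e3 : (Zsᵀ * Zs)ᵀ = Zsᵀ * Zs := by
      rw [Matrix.transpose_mul, Matrix.transpose_transpose]
    have e4 : Nᵀ = Zsᵀ * Zs + Zsᵀ * Δ - (2 * γ) • (Zsᵀ * (G * Zs)) - (2 * γ) • Kᵀ := by
      rw [e1]
      simp only [Matrix.transpose_sub, Matrix.transpose_add, Matrix.transpose_smul, e2, e3, h.symm]
    rw [e4, e1, smul_sub]
    abel
  have hKn : ‖K‖ ≤ s₁ * (opNorm G * ‖Δ‖) :=
    (norm_transpose_mul_le h.s₁_pos.le h.upper _).trans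
      (mul_le_mul_of_nonneg_left (norm_mul_le_opNorm _ _) h.s₁_pos.le)
  have hKK : ‖Kᵀ - K‖ ≤ 2 * (s₁ * (opNorm G * ‖Δ‖)) := by
    refine (norm_sub_le _ _).trans ?_
    rw [Matrix.frobenius_norm_transpose]
    linarith
  rw [hNK, norm_smul, Real.norm_of_nonneg (by positivity)]
  calc _ ≤ 2 * γ * (2 * (s₁ * (opNorm G * ‖Δ‖))) := by gcongr
    _ = _ := by ring

/-- The local conditions hold if the iterate is close enough to `Zs`. -/
theorem of_norm_mul_le (hsm : SmoothOnRegion L D) (h0 : gradAt L Zs = 0) (hrip : LocalRIP L D α β)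
    {Λ : ℝ} (hΛ : 0 < Λ) (hlip : LocalGradLipschitz L D Λ) (hαΛ : α ≤ 5 * Λ)
    (hsr : 0 < sr) (hsr₁ : sr ≤ s₁)
    (hup : ∀ v, l2 (Zs *ᵥ v) ≤ s₁ * l2 v) (hlow : ∀ v, sr * l2 v ≤ l2 (Zs *ᵥ v))
    (hsymm : (Zsᵀ * Δ)ᵀ = Zsᵀ * Δ) (hstep : γ * (α + β) * s₁ ^ 2 = 1 / 10)
    (hd : 1000 * Λ * (‖Δ‖ * s₁) ≤ α * sr ^ 2)
    (hseg : ‖Δ‖ ≤ sr / 200 → ∀ ξ ∈ Set.Icc (0 : ℝ) 1, Zs + ξ • Δ ∈ D) :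
    StepConditions L D Zs Δ α β sr s₁ γ ∧
      opNorm (gradAt L (Zs + Δ)) ≤ 201 / 100 * Λ * (s₁ * ‖Δ‖) := by
  have hs := hsr.trans_le hsr₁
  -- Here `α ≤ 5 Λ` enters: it cancels `Λ` from the smallness hypothesis.
  have hnorm : ‖Δ‖ ≤ sr / 200 := by
    have h1 : 1000 * Λ * (‖Δ‖ * s₁) ≤ 1000 * Λ * (sr / 200 * s₁) := by
      have h2 : α * sr ^ 2 ≤ 5 * Λ * (sr * s₁) := by
        rw [sq]; gcongr
      linarith
    exact le_of_mul_le_mul_right (le_of_mul_le_mul_left h1 (by positivity)) hs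
  have hmem := hseg hnorm
  have hop (ξ : ℝ) (hξ : ξ ∈ Set.Icc (0 : ℝ) 1) :
      opNorm (gradAt L (Zs + ξ • Δ)) ≤ 201 / 100 * Λ * (s₁ * ‖Δ‖) := by
    have h1 := hlip.opNorm_gradAt_le h0 (by simpa using hmem 0 ⟨le_rfl, zero_le_one⟩) (hmem ξ hξ)
    refine (h1.trans (mul_le_mul_of_nonneg_left (norm_gram_sub_gram_le hs.le hup hξ) hΛ.le)).trans ?_
    have h2 : ‖Δ‖ ^ 2 ≤ 1 / 100 * s₁ * ‖Δ‖ := by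
      rw [sq]
      gcongr
      linarith
    have h3 := mul_le_mul_of_nonneg_left h2 hΛ.le
    linarith
  refine ⟨⟨hsm, h0, hrip, hmem, hsr, hsr₁, hup, hlow, hsymm, hnorm, fun ξ hξ => ?_, hstep⟩, ?_⟩
  · refine (hop ξ hξ).trans ?_
    have : 0 ≤ α * sr ^ 2 := mul_nonneg hrip.1.le (sq_nonneg _)
    linarith
  · simpa using hop 1 ⟨zero_le_one, le_rfl⟩

end StepConditions

/-! ### Rotation invariance and realignment. -/

section Aligned
variable {n r : ℕ} {L : Matrix (Fin n) (Fin n) ℝ → ℝ}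

theorem mul_orthogonal_mul_transpose (Z : Matrix (Fin n) (Fin r) ℝ)
    {R : Matrix (Fin r) (Fin r) ℝ} (hR : R * Rᵀ = 1) : (Z * R) * (Z * R)ᵀ = Z * Zᵀ := by
  rw [Matrix.transpose_mul, Matrix.mul_assoc, ← Matrix.mul_assoc R, hR, Matrix.one_mul]

theorem frob_matGrad_mul_orthogonal {Z : Matrix (Fin n) (Fin r) ℝ}
    (hL : DifferentiableAt ℝ L (Z * Zᵀ)) {R : Matrix (Fin r) (Fin r) ℝ} (hR : R * Rᵀ = 1)
    (V : Matrix (Fin n) (Fin r) ℝ) :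
    frob (matGrad (fun Y => L (Y * Yᵀ)) Z * R) V = frob (gradAt L (Z * R)) (tangent (Z * R) V) := by
  rw [frob_mul_eq_right, frob_matGrad_comp_mul_transpose hL, gradAt, gradAt,
    mul_orthogonal_mul_transpose Z hR]
  congr 1
  simp only [tangent, Matrix.transpose_mul, Matrix.transpose_transpose, Matrix.mul_assoc]

theorem IsProcrustes.transpose_mul_sub_comm {Z Zs : Matrix (Fin n) (Fin r) ℝ}
    {R : Matrix (Fin r) (Fin r) ℝ} (h : IsProcrustes Z Zs R) :
    (Zsᵀ * (Z * R - Zs))ᵀ = Zsᵀ * (Z * R - Zs) := by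
  rw [Matrix.mul_sub, Matrix.transpose_sub, h.transpose_mul_comm, Matrix.transpose_mul Zsᵀ Zs,
    Matrix.transpose_transpose]

/-- Expresses the next optimal rotation relative to the current one, as needed to measure the change
of alignment. -/
theorem IsProcrustes.mul_left {Z Zs : Matrix (Fin n) (Fin r) ℝ}
    {R Q : Matrix (Fin r) (Fin r) ℝ} (h : IsProcrustes Z Zs R) (hQ : Q * Qᵀ = 1) :
    IsProcrustes (Z * Q) Zs (Qᵀ * R) := by
  have hQ' : Qᵀ * Q = 1 := mul_eq_one_comm.1 hQ
  have e (A : Matrix (Fin n) (Fin r) ℝ) (B : Matrix (Fin r) (Fin r) ℝ) :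
      Z * Q * (Qᵀ * B) = Z * B := by
    rw [Matrix.mul_assoc, ← Matrix.mul_assoc Q, hQ, Matrix.one_mul]
  refine ⟨?_, fun P hP => ?_⟩
  · rw [Matrix.transpose_mul, Matrix.transpose_transpose, Matrix.mul_assoc, ← Matrix.mul_assoc R,
      h.1, Matrix.one_mul, hQ']
  · rw [e Z, Matrix.mul_assoc Z Q P]
    refine h.2 _ ?_
    rw [Matrix.transpose_mul, Matrix.mul_assoc, ← Matrix.mul_assoc P, hP, Matrix.one_mul, hQ]

theorem l2_row_mul_orthogonal (A : Matrix (Fin n) (Fin r) ℝ) {R : Matrix (Fin r) (Fin r) ℝ}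
    (hR : R * Rᵀ = 1) (i : Fin n) : l2 ((A * R) i) = l2 (A i) := by
  refine (sq_eq_sq₀ (l2_nonneg _) (l2_nonneg _)).1 ?_
  have e : (A * R) i = Rᵀ *ᵥ A i := by
    rw [← row_mul_transpose, Matrix.transpose_transpose]
  rw [l2_sq, e, ← dotProduct_mul_mulVec_eq, Matrix.transpose_transpose, hR, Matrix.one_mulVec,
    l2_sq]

theorem twoInfNorm_mul_sub_le (A Zs : Matrix (Fin n) (Fin r) ℝ) {R : Matrix (Fin r) (Fin r) ℝ}
    (hR : R * Rᵀ = 1) {b : ℝ} (hb : 0 ≤ b) (hA : ∀ i, l2 (A i) ≤ b) :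
    twoInfNorm ((Zs + A) * R - Zs) ≤ b + twoInfNorm Zs * ‖R - 1‖ := by
  have e : (Zs + A) * R - Zs = A * R + Zs * (R - 1) := by
    rw [Matrix.add_mul, Matrix.mul_sub, Matrix.mul_one]; abel
  rw [e]
  refine (twoInfNorm_add_le _ _).trans (add_le_add (twoInfNorm_le hb fun i => ?_)
    (twoInfNorm_le (mul_nonneg (twoInfNorm_nonneg _) (norm_nonneg _)) fun i => ?_))
  · rw [l2_row_mul_orthogonal A hR]; exact hA i
  · have e' : (Zs * (R - 1) : Matrix (Fin n) (Fin r) ℝ) i = (R - 1)ᵀ *ᵥ Zs i := by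
      rw [← row_mul_transpose, Matrix.transpose_transpose]
    rw [e', mul_comm]
    refine (l2_mulVec_le_norm _ _).trans ?_
    rw [Matrix.frobenius_norm_transpose]
    gcongr
    exact l2_row_le_twoInfNorm _ i

/-- The spectral constants of `Zs` in terms of its extreme singular values. -/
theorem exists_spectral_bounds {Zs : Matrix (Fin n) (Fin r) ℝ} (hr : 0 < r) (h : Zs.rank = r) :
    ∃ sr s₁ : ℝ, 0 < sr ∧ sr ≤ s₁ ∧ (∀ v, l2 (Zs *ᵥ v) ≤ s₁ * l2 v) ∧
      (∀ v, sr * l2 v ≤ l2 (Zs *ᵥ v)) ∧ condNumber Zs = s₁ ^ 2 / sr ^ 2 ∧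
      sigmaMin Zs = sr ^ 2 / n ∧ ‖Zs‖ ≤ √(r : ℝ) * s₁ := by
  have hpos := sigma_pos_of_rank Zs hr h
  have hle := sigma_le_sigma_one (r := r) Zs
  refine ⟨√(sigma r (Zs * Zsᵀ)), √(sigma 1 (Zs * Zsᵀ)), Real.sqrt_pos.2 hpos,
    Real.sqrt_le_sqrt hle, fun v => ?_, fun v => ?_, ?_, ?_, ?_⟩
  · refine le_of_sq_le_sq ?_ (mul_nonneg (Real.sqrt_nonneg _) (l2_nonneg v))
    rw [mul_pow, Real.sq_sqrt (hpos.le.trans hle)]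
    exact l2_mulVec_sq_le_sigma Zs v
  · refine le_of_sq_le_sq ?_ (l2_nonneg _)
    rw [mul_pow, Real.sq_sqrt hpos.le]
    exact sigma_mul_l2_sq_le Zs h v
  · rw [Real.sq_sqrt hpos.le, Real.sq_sqrt (hpos.le.trans hle), condNumber]
  · rw [Real.sq_sqrt hpos.le, sigmaMin]
  · refine le_of_sq_le_sq ?_ (by positivity)
    rw [mul_pow, Real.sq_sqrt (hpos.le.trans hle), Real.sq_sqrt (by positivity)]
    exact norm_sq_le_of_l2_mulVec_sq_le Zs (l2_mulVec_sq_le_sigma Zs)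

end Aligned

/-! ### Step size, rate and radii in terms of `sr` and `s₁`. -/

section StepSize
variable {n r : ℕ} {Zs : Matrix (Fin n) (Fin r) ℝ} {α β sr s₁ : ℝ}

theorem stepSize_eq (hsr : 0 < sr) (hκ : condNumber Zs = s₁ ^ 2 / sr ^ 2)
    (hσ : sigmaMin Zs = sr ^ 2 / n) :
    stepSize Zs α β = n * (10 * (α + β) * s₁ ^ 2)⁻¹ := by
  rw [stepSize, hκ, hσ]
  have : 10 * (α + β) * (s₁ ^ 2 / sr ^ 2) * (sr ^ 2 / n) = 10 * (α + β) * s₁ ^ 2 / n := by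
    field_simp
  rw [this, inv_div, div_eq_mul_inv]

theorem rate_eq (hn : (n : ℝ) ≠ 0) (hsr : 0 < sr) (hκ : condNumber Zs = s₁ ^ 2 / sr ^ 2)
    (hσ : sigmaMin Zs = sr ^ 2 / n) :
    rate Zs α β = 1 - (10 * (α + β) * s₁ ^ 2)⁻¹ * (α * sr ^ 2) / 4 := by
  rw [rate, stepSize_eq hsr hκ hσ, hσ]
  field_simp

theorem mul_norm_mul_le_of_le_div {φ c N : ℝ} (hr : 0 < r) (hsr : 0 < sr) (hs : 0 < s₁)
    (hκ : condNumber Zs = s₁ ^ 2 / sr ^ 2) (hφ0 : 0 ≤ φ) (hN : N ≤ √(r : ℝ) * s₁)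
    (hφ : φ ≤ c * (α / (condNumber Zs * √(r : ℝ)))) : φ * N * s₁ ≤ c * (α * sr ^ 2) := by
  have hr' : 0 < √(r : ℝ) := Real.sqrt_pos.2 (by exact_mod_cast hr)
  calc φ * N * s₁ ≤ φ * (√(r : ℝ) * s₁) * s₁ := by gcongr
    _ = φ * (√(r : ℝ) * s₁ ^ 2) := by ring
    _ ≤ c * (α / (condNumber Zs * √(r : ℝ))) * (√(r : ℝ) * s₁ ^ 2) := by gcongr
    _ = c * (α * sr ^ 2) := by rw [hκ]; field_simp

/-- The power `κ^{3/2}` is `(s₁ / sr)³`, and `√r` pays for passing from `s₁` to the Frobenius norm.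
-/
theorem mul_norm_mul_le_of_div_le {φ ψ c N : ℝ} (hα : 0 < α) (hβ : 0 < β)
    (hsr : 0 < sr) (hs : 0 < s₁) (hψ : 0 < ψ)
    (hκ : condNumber Zs = s₁ ^ 2 / sr ^ 2) (hφ0 : 0 ≤ φ) (hN : N ≤ √(r : ℝ) * s₁)
    (h : β / α * condNumber Zs ^ (3 / 2 : ℝ) * √(r : ℝ) * (φ / ψ) ≤ c) :
    φ * N * (β * s₁ ^ 2) ≤ c * ψ * (α * sr ^ 3) := by
  have e : condNumber Zs ^ (3 / 2 : ℝ) = s₁ ^ 3 / sr ^ 3 := by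
    rw [hκ, ← div_pow, ← div_pow, ← Real.rpow_natCast (s₁ / sr) 2,
      ← Real.rpow_mul (by positivity), ← Real.rpow_natCast (s₁ / sr) 3]
    norm_num
  calc φ * N * (β * s₁ ^ 2) ≤ φ * (√(r : ℝ) * s₁) * (β * s₁ ^ 2) := by gcongr
    _ = (β / α * (s₁ ^ 3 / sr ^ 3) * √(r : ℝ) * (φ / ψ)) * (ψ * (α * sr ^ 3)) := by
      field_simp
    _ ≤ c * (ψ * (α * sr ^ 3)) := by
      rw [e] at h
      gcongr
    _ = _ := by ring

end StepSize

/-! ### One step of gradient descent in both distances. -/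

section Step
variable {n r : ℕ} {L : Matrix (Fin n) (Fin n) ℝ → ℝ} {D : Set (Matrix (Fin n) (Fin r) ℝ)}
  {Zs Z Z' : Matrix (Fin n) (Fin r) ℝ} {α β sr s₁ γ ρ : ℝ}

/-- The contraction of `dist_2` in one step of gradient descent. -/
theorem distTwo_step_le
    (h : StepConditions L D Zs (Z * procrustes Z Zs - Zs) α β sr s₁ γ)
    (hZ' : Z' = Z - γ • matGrad (fun Y => L (Y * Yᵀ)) Z)
    (hρ : ρ = 1 - γ * (α * sr ^ 2) / 4) : distTwo Z' Zs ≤ ρ * distTwo Z Zs := by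
  have hR := (procrustes_spec Z Zs).1
  set R := procrustes Z Zs with hRdef
  have hx := h.γ_mul_α_le
  have hsm : DifferentiableAt ℝ L (Z * Zᵀ) := by
    have := h.contDiffAt 1 ⟨zero_le_one, le_rfl⟩
    rw [one_smul, add_sub_cancel, mul_orthogonal_mul_transpose Z hR] at this
    exact this.differentiableAt (by norm_num)
  have h1 := h.norm_sub_smul_sq_le (W := matGrad (fun Y => L (Y * Yᵀ)) Z * R) fun V => by
    rw [add_sub_cancel]
    exact frob_matGrad_mul_orthogonal hsm hR V
  have e : Z' * R - Zs = Z * R - Zs - γ • (matGrad (fun Y => L (Y * Yᵀ)) Z * R) := by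
    rw [hZ', Matrix.sub_mul, Matrix.smul_mul]; abel
  -- The old rotation `R` is a competitor for `Z'`. Then `1 - x ≤ (1 - x / 4) ^ 2` for `x ≥ 0` gives
  -- the rate.
  refine (norm_mul_procrustes_sub_le Z' Zs hR).trans (le_of_sq_le_sq ?_ ?_)
  · rw [e, mul_pow]
    refine h1.trans ?_
    change _ ≤ ρ ^ 2 * ‖Z * R - Zs‖ ^ 2
    refine mul_le_mul_of_nonneg_right ?_ (sq_nonneg _)
    have : 0 ≤ γ * (α * sr ^ 2) := mul_nonneg h.γ_pos.le (mul_nonneg h.rip.1.le (sq_nonneg _))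
    rw [hρ]
    nlinarith
  · exact mul_nonneg (by linarith) (norm_nonneg _)

/-- The contraction of `dist_∞` in one step of gradient descent. -/
theorem distInf_step_le
    (h : StepConditions L D Zs (Z * procrustes Z Zs - Zs) α β sr s₁ γ)
    (hZ' : Z' = Z - γ • matGrad (fun Y => L (Y * Yᵀ)) Z)
    (hρ : ρ = 1 - γ * (α * sr ^ 2) / 4)
    (hsymm : ∀ Y ∈ D, (gradAt L Y)ᵀ = gradAt L Y) (hrow : RowHessianBound L D β)
    {Λ Λi c E q : ℝ} (hΛ : 1 ≤ Λ) (hΛi : 0 ≤ Λi) (hE : 0 ≤ E) (hlip : RowGradLipschitz L D Λi)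
    (hop : opNorm (gradAt L (Z * procrustes Z Zs)) ≤ 201 / 100 * Λ * (s₁ * distTwo Z Zs))
    (hc : 0 < c) (hcΛ : 1000 * (c * Λ) ≤ 1) (hcΛi : 1000 * (c * Λi) ≤ 1)
    (hcE : 1000 * (c * (1 + E)) ≤ 1)
    (hq : distInf Z Zs ≤ q * twoInfNorm Zs) (hqE : q ≤ E) (hq0 : 0 ≤ q)
    (hd : distTwo Z Zs * s₁ ≤ c * (α * sr ^ 2))
    (hdq : distTwo Z Zs * (β * s₁ ^ 2) ≤ c * q * (α * sr ^ 3)) :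
    distInf Z' Zs ≤ ρ * (q * twoInfNorm Zs) := by
  have hR := (procrustes_spec Z Zs).1
  unfold distInf distTwo at *
  set R := procrustes Z Zs with hRdef
  set Δ := Z * R - Zs with hΔ
  have hx := h.γ_mul_α_le
  have hγ := h.γ_pos
  have hα := h.rip.1
  have hβ := h.β_pos
  have hs := h.s₁_pos
  have hsr := h.sr_pos
  have hsr₁ := h.sr_le
  have hZR : Zs + Δ = Z * R := by rw [hΔ, add_sub_cancel]
  have hmem : Z * R ∈ D := by
    simpa [hZR] using h.segment_mem 1 ⟨zero_le_one, le_rfl⟩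
  have hsm : DifferentiableAt ℝ L (Z * Zᵀ) := by
    have := h.smooth _ hmem
    rw [mul_orthogonal_mul_transpose Z hR] at this
    exact this.differentiableAt (by norm_num)
  set W := matGrad (fun Y => L (Y * Yᵀ)) Z * R with hWdef
  have hW (V) : frob W V = frob (gradAt L (Zs + Δ)) (tangent (Zs + Δ) V) := by
    rw [hZR]; exact frob_matGrad_mul_orthogonal hsm hR V
  have e : Z' * R = Zs + (Δ - γ • W) := by
    rw [hZ', hΔ, hWdef, Matrix.sub_mul, Matrix.smul_mul]; abel
  set m := twoInfNorm Zs with hm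
  have hm0 : 0 ≤ m := twoInfNorm_nonneg Zs
  set d := ‖Δ‖ with hd_def
  have hd0 : 0 ≤ d := norm_nonneg Δ
  have hds : d ≤ s₁ / 200 := h.norm_le.trans (by linarith)
  set u := α * sr ^ 2 with hu
  have hu0 : 0 < u := by positivity
  set b := q * m with hb
  have hb0 : 0 ≤ b := mul_nonneg hq0 hm0
  have hc1 : 1000 * c ≤ 1 := by nlinarith
  have hβd : β * s₁ * d ≤ c * q * u := by
    have h1 : (β * s₁ * d) * s₁ ≤ (c * q * u) * s₁ := by
      calc _ = d * (β * s₁ ^ 2) := by ring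
        _ ≤ c * q * (α * sr ^ 3) := hdq
        _ = (c * q * u) * sr := by rw [hu]; ring
        _ ≤ _ := by gcongr
    exact le_of_mul_le_mul_right h1 hs
  have hds2 : d * s₁ ^ 2 ≤ c * q * sr ^ 3 := by
    have h1 : (d * s₁ ^ 2) * β ≤ (c * q * sr ^ 3) * β := by
      calc _ = d * (β * s₁ ^ 2) := by ring
        _ ≤ c * q * (α * sr ^ 3) := hdq
        _ = (c * q * sr ^ 3) * α := by ring
        _ ≤ _ := by gcongr; exact h.rip.2.1
    exact le_of_mul_le_mul_right h1 hβ
  have hdq' : d ≤ c * q * sr := by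
    have h1 : d * s₁ ^ 2 ≤ (c * q * sr) * s₁ ^ 2 := by
      calc _ ≤ c * q * sr ^ 3 := hds2
        _ = (c * q * sr) * sr ^ 2 := by ring
        _ ≤ _ := by gcongr
    exact le_of_mul_le_mul_right h1 (by positivity)
  have hcross : β * (m + b) * ((s₁ + d) * d) ≤ u * b / 100 := by
    -- Row norms on the segment are at most `(1 + E) m`; this is how the bound on `ε` enters the
    -- constant.
    have h1 : m + b ≤ (1 + E) * m := by
      have := mul_le_mul_of_nonneg_right hqE hm0
      linarith
    calc _ ≤ β * ((1 + E) * m) * ((2 * s₁) * d) := by gcongr; linarith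
      _ = 2 * ((1 + E) * m) * (β * s₁ * d) := by ring
      _ ≤ 2 * ((1 + E) * m) * (c * q * u) := by gcongr
      _ = 2 * (c * (1 + E)) * (u * b) := by rw [hb]; ring
      _ ≤ 2 * (1 / 1000) * (u * b) := by gcongr; linarith
      _ ≤ _ := by have := mul_nonneg hu0.le hb0; linarith
  have hrem : 2 * (Λi * (b * (s₁ + d) + m * d)) * d ≤ u * b / 100 := by
    have h1 : b * (s₁ + d) * d ≤ 2 * c * (u * b) := by
      calc _ ≤ b * (2 * s₁) * d := by gcongr; linarith
        _ = 2 * b * (d * s₁) := by ring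
        _ ≤ 2 * b * (c * u) := by gcongr
        _ = _ := by ring
    have h2 : m * d * d ≤ c * (u * b) := by
      calc _ ≤ m * (c * q * sr) * d := by gcongr
        _ = c * b * (d * sr) := by rw [hb]; ring
        _ ≤ c * b * (d * s₁) := by gcongr
        _ ≤ c * b * (c * u) := by gcongr
        _ = c * (c * (u * b)) := by ring
        _ ≤ 1 * (c * (u * b)) := by gcongr; linarith
        _ = _ := one_mul _
    calc _ = 2 * Λi * (b * (s₁ + d) * d + m * d * d) := by ring
      _ ≤ 2 * Λi * (2 * c * (u * b) + c * (u * b)) := by gcongr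
      _ = 6 * (c * Λi) * (u * b) := by ring
      _ ≤ 6 * (1 / 1000) * (u * b) := by gcongr; linarith
      _ ≤ _ := by have := mul_nonneg hu0.le hb0; linarith
  have hrows := h.l2_row_sub_smul_le hW hsymm hrow hΛi hlip hq hcross hrem
  have hproc := (procrustes_spec Z' Zs).mul_left hR
  rw [e] at hproc
  have hrot := h.mul_norm_sub_one_le hW (by rw [hZR]; exact hsymm _ hmem) hproc
  have hfin := twoInfNorm_mul_sub_le (Δ - γ • W) Zs hproc.1
    (mul_nonneg (by linarith) hb0) hrows
  have e2 : (Zs + (Δ - γ • W)) * (Rᵀ * procrustes Z' Zs) = Z' * procrustes Z' Zs := by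
    rw [← e, Matrix.mul_assoc, ← Matrix.mul_assoc R, hR, Matrix.one_mul]
  rw [e2] at hfin
  refine hfin.trans ?_
  -- The rotation is quadratic in `d`: one factor is traded for `q` through `hds2`, the other for
  -- the small `c * u`. The total factor is `1 - 1.79 γ u`, below `ρ`.
  have hrotm : m * ‖Rᵀ * procrustes Z' Zs - 1‖ ≤ 1 / 100 * (γ * u) * b := by
    set κ := ‖Rᵀ * procrustes Z' Zs - 1‖
    rw [hZR] at hrot
    have h1 : (9 / 10 * sr ^ 2) * (m * κ) ≤ (9 / 10 * sr ^ 2) * (1 / 100 * (γ * u) * b) := by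
      calc _ = m * (9 / 10 * sr ^ 2 * κ) := by ring
        _ ≤ m * (4 * γ * s₁ * (201 / 100 * Λ * (s₁ * d)) * d) :=
          mul_le_mul_of_nonneg_left (hrot.trans (by gcongr)) hm0
        _ = 804 / 100 * γ * Λ * m * d * (d * s₁ ^ 2) := by ring
        _ ≤ 804 / 100 * γ * Λ * m * d * (c * q * sr ^ 3) := by gcongr
        _ = 804 / 100 * γ * (c * Λ) * b * sr ^ 2 * (d * sr) := by rw [hb]; ring
        _ ≤ 804 / 100 * γ * (1 / 1000) * b * sr ^ 2 * (c * u) := by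
          have : d * sr ≤ c * u := (mul_le_mul_of_nonneg_left hsr₁ hd0).trans hd
          gcongr
          linarith
        _ = 804 / 100000 * c * (γ * u * b * sr ^ 2) := by ring
        _ ≤ 804 / 100000 * (1 / 1000) * (γ * u * b * sr ^ 2) := by gcongr; linarith
        _ ≤ _ := by
          have : 0 ≤ γ * u * b * sr ^ 2 := by positivity
          linarith
    exact le_of_mul_le_mul_left h1 (by positivity)
  have : 0 ≤ γ * u * b := by positivity
  rw [hρ]
  linarith

end Step

/-! ### The local regions and the segments inside them. -/

section Setup
variable {n r : ℕ} {Zs : Matrix (Fin n) (Fin r) ℝ}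

theorem pos_of_rank_eq (hr : 0 < r) (h : Zs.rank = r) : 0 < n := by
  have := Zs.rank_le_height
  omega

theorem mulVec_single_ne_zero {sr : ℝ} (hsr : 0 < sr) (hlow : ∀ v, sr * l2 v ≤ l2 (Zs *ᵥ v))
    (j : Fin r) : Zs *ᵥ Pi.single j 1 ≠ 0 := fun h => by
  have h1 := hlow (Pi.single j 1)
  have h2 : l2 (Pi.single j (1 : ℝ)) ^ 2 = 1 := by rw [l2_sq]; simp
  have h3 : l2 (0 : Fin n → ℝ) = 0 := norm_zero
  rw [h, h3] at h1
  have h4 := nonpos_of_mul_nonpos_right h1 hsr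
  have h5 := l2_nonneg (Pi.single j (1 : ℝ))
  rw [le_antisymm h4 h5] at h2
  norm_num at h2

theorem ne_zero_of_mulVec_ne_zero {v : Fin r → ℝ} (h : Zs *ᵥ v ≠ 0) : Zs ≠ 0 := by
  rintro rfl
  simp at h

theorem twoInfNorm_pos (h : Zs ≠ 0) : 0 < twoInfNorm Zs := by
  refine lt_of_le_of_ne (twoInfNorm_nonneg _) fun h0 => h ?_
  ext i j
  have h1 := l2_row_le_twoInfNorm Zs i
  rw [← h0] at h1
  have h2 : WithLp.toLp 2 (Zs i) = 0 := norm_le_zero_iff.1 h1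
  exact congrFun (congrArg WithLp.ofLp h2) j

theorem mem_regionTwo_iff {ε : ℝ} (h : Zs ≠ 0) {Y : Matrix (Fin n) (Fin r) ℝ} :
    Y ∈ regionTwo Zs ε ↔ distTwo Y Zs ≤ ε * ‖Zs‖ :=
  div_le_iff₀ (norm_pos_iff.2 h)

theorem mem_regionInf_iff {ε : ℝ} (h : Zs ≠ 0) {Y : Matrix (Fin n) (Fin r) ℝ} :
    Y ∈ regionInf Zs ε ↔ distTwo Y Zs ≤ ε * ‖Zs‖ ∧ distInf Y Zs ≤ ε * twoInfNorm Zs :=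
  and_congr (div_le_iff₀ (norm_pos_iff.2 h)) (div_le_iff₀ (twoInfNorm_pos h))

theorem distTwo_add_smul_le (Δ : Matrix (Fin n) (Fin r) ℝ) {ξ : ℝ}
    (hξ : ξ ∈ Set.Icc (0 : ℝ) 1) : distTwo (Zs + ξ • Δ) Zs ≤ ‖Δ‖ := by
  refine (distTwo_le _ _).trans ?_
  rw [add_sub_cancel_left]
  exact norm_smul_le_of_mem_Icc hξ Δ

/-- Along the segment from `Zs` to an aligned matrix close to it, no realignment is needed. -/
theorem distInf_add_smul_le {Δ : Matrix (Fin n) (Fin r) ℝ} {sr ξ : ℝ} (hsr : 0 < sr)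
    (hlow : ∀ v, sr * l2 v ≤ l2 (Zs *ᵥ v)) (hsymm : (Zsᵀ * Δ)ᵀ = Zsᵀ * Δ)
    (hΔ : ‖Δ‖ < sr) (hξ : ξ ∈ Set.Icc (0 : ℝ) 1) :
    distInf (Zs + ξ • Δ) Zs ≤ twoInfNorm Δ := by
  -- Unlike `distTwo`, `distInf` is not minimised by the chosen rotation, so the rotation itself
  -- must be identified.
  have h1 : procrustes (Zs + ξ • Δ) Zs = 1 := by
    refine procrustes_eq_one (a := sr * (sr - ‖Δ‖)) (mul_pos hsr (by linarith))
      (le_dotProduct_transpose_mul_mulVec hlow ?_ hΔ.le) ?_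
    · rw [add_sub_cancel_left]
      exact norm_smul_le_of_mem_Icc hξ Δ
    · rw [Matrix.mul_add, Matrix.transpose_add, Matrix.mul_smul, Matrix.transpose_smul, hsymm,
        Matrix.transpose_mul Zsᵀ Zs, Matrix.transpose_transpose]
  rw [distInf, h1, Matrix.mul_one, add_sub_cancel_left]
  exact (twoInfNorm_smul_le hξ.1 Δ).trans
    (mul_le_of_le_one_left (twoInfNorm_nonneg _) hξ.2)

end Setup

/-! ### Induction along the trajectory. -/

theorem distTwo_contraction {n r : ℕ} {L : Matrix (Fin n) (Fin n) ℝ → ℝ}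
    {Zs : Matrix (Fin n) (Fin r) ℝ} {α β ε φ L₂ Λ c : ℝ} {Z : ℕ → Matrix (Fin n) (Fin r) ℝ}
    (hΛ : 1 ≤ Λ) (hL₂ : L₂ ≤ Λ) (hcΛ : 1000 * (c * Λ) ≤ 1)
    (hr : 0 < r) (hrank : Zs.rank = r) (hε : 0 < ε)
    (hsm : SmoothOnRegion L (regionTwo Zs ε)) (h0 : gradAt L Zs = 0)
    (hrip : LocalRIP L (regionTwo Zs ε) α β)
    (hlip : LocalGradLipschitz L (regionTwo Zs ε) L₂)
    (hgd : IsGradientDescent L (stepSize Zs α β) Z)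
    (hinit : distTwo (Z 0) Zs ≤ φ * ‖Zs‖)
    (hφ : φ ≤ min (ε / 2) (c * (α / (condNumber Zs * √(r : ℝ))))) (t : ℕ) :
    distTwo (Z t) Zs ≤ rate Zs α β ^ t * φ * ‖Zs‖ := by
  obtain ⟨sr, s₁, hsr, hsr₁, hup, hlow, hκ, hσ, hN⟩ := exists_spectral_bounds hr hrank
  have hn : (n : ℝ) ≠ 0 := by exact_mod_cast (pos_of_rank_eq hr hrank).ne'
  have hs := hsr.trans_le hsr₁
  have hα := hrip.1
  have hβ := hα.trans_le hrip.2.1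
  have hj := mulVec_single_ne_zero hsr hlow ⟨0, hr⟩
  have hZs := ne_zero_of_mulVec_ne_zero hj
  have hZs0 := norm_pos_iff.2 hZs
  have hlip' := hlip.mono hL₂
  have hΛ0 : 0 < Λ := by linarith
  have hαΛ := hrip.le_of_localGradLipschitz hlip' hΛ0.le hsm h0 (mul_pos hε hZs0)
    (fun Y hY => (mem_regionTwo_iff hZs).2 ((distTwo_le _ _).trans hY)) _ hj
  have hφ0 : 0 ≤ φ := nonneg_of_mul_nonneg_left ((norm_nonneg _).trans hinit) hZs0
  have hφε := hφ.trans (min_le_left _ _)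
  have hsmall := mul_norm_mul_le_of_le_div hr hsr hs hκ hφ0 hN (hφ.trans (min_le_right _ _))
  set γ := (10 * (α + β) * s₁ ^ 2)⁻¹ with hγ
  have hγstep : γ * (α + β) * s₁ ^ 2 = 1 / 10 := by
    have : 0 < α + β := by linarith
    rw [hγ]; field_simp
  have hρ : rate Zs α β = 1 - γ * (α * sr ^ 2) / 4 := rate_eq hn hsr hκ hσ
  have hγn : (n : ℝ)⁻¹ * stepSize Zs α β = γ := by
    rw [stepSize_eq hsr hκ hσ, inv_mul_cancel_left₀ hn]
  have key (Y : Matrix (Fin n) (Fin r) ℝ) (hY : distTwo Y Zs ≤ φ * ‖Zs‖) :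
      StepConditions L (regionTwo Zs ε) Zs (Y * procrustes Y Zs - Zs) α β sr s₁ γ := by
    refine (StepConditions.of_norm_mul_le hsm h0 hrip hΛ0 hlip' hαΛ hsr hsr₁ hup hlow
      (procrustes_spec Y Zs).transpose_mul_sub_comm hγstep ?_ fun _ ξ hξ => ?_).1
    · have h1 : distTwo Y Zs * s₁ ≤ c * (α * sr ^ 2) :=
        (mul_le_mul_of_nonneg_right hY hs.le).trans hsmall
      calc _ ≤ 1000 * Λ * (c * (α * sr ^ 2)) :=
          mul_le_mul_of_nonneg_left h1 (by positivity)
        _ = 1000 * (c * Λ) * (α * sr ^ 2) := by ring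
        _ ≤ _ := mul_le_of_le_one_left (by positivity) hcΛ
    · refine (mem_regionTwo_iff hZs).2 ((distTwo_add_smul_le _ hξ).trans (hY.trans ?_))
      gcongr
      linarith
  have hx := (key _ hinit).γ_mul_α_le
  have hx0 : 0 ≤ γ * (α * sr ^ 2) := by positivity
  have hρ0 : 0 ≤ rate Zs α β := by rw [hρ]; linarith
  have hρ1 : rate Zs α β ≤ 1 := by rw [hρ]; linarith
  induction t with
  | zero => simpa using hinit
  | succ t ih =>
    have hY : distTwo (Z t) Zs ≤ φ * ‖Zs‖ := ih.trans (by
      gcongr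
      exact mul_le_of_le_one_left hφ0 (pow_le_one₀ hρ0 hρ1))
    have hZ' : Z (t + 1) = Z t - γ • matGrad (fun Y => L (Y * Yᵀ)) (Z t) := by rw [hgd t, hγn]
    calc _ ≤ _ := distTwo_step_le (key _ hY) hZ' hρ
      _ ≤ rate Zs α β * (rate Zs α β ^ t * φ * ‖Zs‖) := by gcongr
      _ = _ := by ring

theorem distInf_contraction {n r : ℕ} {L : Matrix (Fin n) (Fin n) ℝ → ℝ}
    {Zs : Matrix (Fin n) (Fin r) ℝ} {α β ε φ ψ L₂ Linf Λ Λi E c : ℝ}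
    {Z : ℕ → Matrix (Fin n) (Fin r) ℝ}
    (hΛ : 1 ≤ Λ) (hL₂ : L₂ ≤ Λ) (hΛi : 0 ≤ Λi) (hLinf : Linf ≤ Λi) (hE : 0 ≤ E)
    (hc : 0 < c) (hcΛ : 1000 * (c * Λ) ≤ 1) (hcΛi : 1000 * (c * Λi) ≤ 1)
    (hcE : 1000 * (c * (1 + E)) ≤ 1)
    (hr : 0 < r) (hrank : Zs.rank = r) (hε : 0 < ε) (hεE : ε ≤ E)
    (hsm : SmoothOnRegion L (regionInf Zs ε))
    (hsymm : ∀ Y ∈ regionInf Zs ε, (gradAt L Y)ᵀ = gradAt L Y) (h0 : gradAt L Zs = 0)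
    (hrip : LocalRIP L (regionInf Zs ε) α β)
    (hlip : LocalGradLipschitz L (regionInf Zs ε) L₂)
    (hrow : RowHessianBound L (regionInf Zs ε) β)
    (hlipi : RowGradLipschitz L (regionInf Zs ε) Linf)
    (hgd : IsGradientDescent L (stepSize Zs α β) Z)
    (hinit : distTwo (Z 0) Zs ≤ φ * ‖Zs‖)
    (hφ : φ ≤ min (ε / 2) (c * (α / (condNumber Zs * √(r : ℝ)))))
    (hiniti : distInf (Z 0) Zs ≤ ψ * twoInfNorm Zs) (hψ : 0 < ψ) (hψε : ψ ≤ ε / 2)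
    (hφψ : β / α * condNumber Zs ^ (3 / 2 : ℝ) * √(r : ℝ) * (φ / ψ) ≤ c) (t : ℕ) :
    distTwo (Z t) Zs ≤ rate Zs α β ^ t * φ * ‖Zs‖ ∧
      distInf (Z t) Zs ≤ rate Zs α β ^ t * ψ * twoInfNorm Zs := by
  obtain ⟨sr, s₁, hsr, hsr₁, hup, hlow, hκ, hσ, hN⟩ := exists_spectral_bounds hr hrank
  have hn : (n : ℝ) ≠ 0 := by exact_mod_cast (pos_of_rank_eq hr hrank).ne'
  have hs := hsr.trans_le hsr₁
  have hα := hrip.1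
  have hβ := hα.trans_le hrip.2.1
  have hj := mulVec_single_ne_zero hsr hlow ⟨0, hr⟩
  have hZs := ne_zero_of_mulVec_ne_zero hj
  have hZs0 := norm_pos_iff.2 hZs
  have hm0 := twoInfNorm_pos hZs
  have hlip' := hlip.mono hL₂
  have hlipi' : RowGradLipschitz L (regionInf Zs ε) Λi := fun Y₁ h₁ Y₂ h₂ =>
    (hlipi Y₁ h₁ Y₂ h₂).trans (mul_le_mul_of_nonneg_right hLinf (twoInfNorm_nonneg _))
  have hΛ0 : 0 < Λ := by linarith
  have hαΛ := hrip.le_of_localGradLipschitz hlip' hΛ0.le hsm h0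
    (lt_min (mul_pos hε hZs0) (mul_pos hε hm0))
    (fun Y hY => (mem_regionInf_iff hZs).2
      ⟨(distTwo_le _ _).trans (hY.trans (min_le_left _ _)),
        (distInf_le_distTwo _ _).trans ((distTwo_le _ _).trans (hY.trans (min_le_right _ _)))⟩) _ hj
  have hφ0 : 0 ≤ φ := nonneg_of_mul_nonneg_left ((norm_nonneg _).trans hinit) hZs0
  have hφε := hφ.trans (min_le_left _ _)
  have hsmall := mul_norm_mul_le_of_le_div hr hsr hs hκ hφ0 hN (hφ.trans (min_le_right _ _))
  have hratio := mul_norm_mul_le_of_div_le hα hβ hsr hs hψ hκ hφ0 hN hφψ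
  set γ := (10 * (α + β) * s₁ ^ 2)⁻¹ with hγ
  have hγstep : γ * (α + β) * s₁ ^ 2 = 1 / 10 := by
    have : 0 < α + β := by linarith
    rw [hγ]; field_simp
  have hρ : rate Zs α β = 1 - γ * (α * sr ^ 2) / 4 := rate_eq hn hsr hκ hσ
  have hγn : (n : ℝ)⁻¹ * stepSize Zs α β = γ := by
    rw [stepSize_eq hsr hκ hσ, inv_mul_cancel_left₀ hn]
  have key (Y : Matrix (Fin n) (Fin r) ℝ) (hY : distTwo Y Zs ≤ φ * ‖Zs‖)
      (hYi : distInf Y Zs ≤ ψ * twoInfNorm Zs) :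
      StepConditions L (regionInf Zs ε) Zs (Y * procrustes Y Zs - Zs) α β sr s₁ γ ∧
        opNorm (gradAt L (Y * procrustes Y Zs)) ≤ 201 / 100 * Λ * (s₁ * distTwo Y Zs) := by
    have hsy := (procrustes_spec Y Zs).transpose_mul_sub_comm
    have h := StepConditions.of_norm_mul_le (Δ := Y * procrustes Y Zs - Zs)
      hsm h0 hrip hΛ0 hlip' hαΛ hsr hsr₁ hup hlow hsy hγstep ?_ fun hd ξ hξ => ?_
    · rwa [add_sub_cancel] at h
    · have h1 : distTwo Y Zs * s₁ ≤ c * (α * sr ^ 2) :=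
        (mul_le_mul_of_nonneg_right hY hs.le).trans hsmall
      calc _ ≤ 1000 * Λ * (c * (α * sr ^ 2)) :=
          mul_le_mul_of_nonneg_left h1 (by positivity)
        _ = 1000 * (c * Λ) * (α * sr ^ 2) := by ring
        _ ≤ _ := mul_le_of_le_one_left (by positivity) hcΛ
    · refine (mem_regionInf_iff hZs).2 ⟨(distTwo_add_smul_le _ hξ).trans (hY.trans ?_),
        (distInf_add_smul_le hsr hlow hsy (by linarith) hξ).trans (hYi.trans ?_)⟩
      · gcongr
        linarith
      · gcongr
        linarith
  have hx := (key _ hinit hiniti).1.γ_mul_α_le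
  have hx0 : 0 ≤ γ * (α * sr ^ 2) := by positivity
  have hρ0 : 0 ≤ rate Zs α β := by rw [hρ]; linarith
  have hρ1 : rate Zs α β ≤ 1 := by rw [hρ]; linarith
  induction t with
  | zero => simpa using ⟨hinit, hiniti⟩
  | succ t ih =>
    have hpow0 : 0 ≤ rate Zs α β ^ t := pow_nonneg hρ0 t
    have hpow1 : rate Zs α β ^ t ≤ 1 := pow_le_one₀ hρ0 hρ1
    have hqψ : rate Zs α β ^ t * ψ ≤ ψ := mul_le_of_le_one_left hψ.le hpow1
    have hY : distTwo (Z t) Zs ≤ φ * ‖Zs‖ := ih.1.trans (by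
      gcongr
      exact mul_le_of_le_one_left hφ0 hpow1)
    have hYi : distInf (Z t) Zs ≤ ψ * twoInfNorm Zs := ih.2.trans (by gcongr)
    obtain ⟨hstep, hop⟩ := key _ hY hYi
    have hZ' : Z (t + 1) = Z t - γ • matGrad (fun Y => L (Y * Yᵀ)) (Z t) := by rw [hgd t, hγn]
    refine ⟨?_, ?_⟩
    · calc _ ≤ _ := distTwo_step_le hstep hZ' hρ
        _ ≤ rate Zs α β * (rate Zs α β ^ t * φ * ‖Zs‖) := by gcongr; exact ih.1
        _ = _ := by ring
    -- Applied with the current relative radius `q = ρ^t ψ`; the factor `ρ^t` appears on both sides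
    -- of the ratio condition.
    · have := distInf_step_le hstep hZ' hρ hsymm hrow hΛ hΛi hE hlipi' hop hc hcΛ hcΛi hcE ih.2
        (by linarith) (mul_nonneg hpow0 hψ.le)
        ((mul_le_mul_of_nonneg_right hY hs.le).trans hsmall)
        (by
          calc _ ≤ (rate Zs α β ^ t * φ * ‖Zs‖) * (β * s₁ ^ 2) := by gcongr; exact ih.1
            _ = rate Zs α β ^ t * (φ * ‖Zs‖ * (β * s₁ ^ 2)) := by ring
            _ ≤ rate Zs α β ^ t * (c * ψ * (α * sr ^ 3)) := by gcongr
            _ = _ := by ring)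
      calc _ ≤ _ := this
        _ = _ := by ring

theorem theorem2 :
    -- `ℓ₂`-error contraction
    (∀ L₂ : ℝ, ∃ c₀ : ℝ, 0 < c₀ ∧
      ∀ (n r : ℕ) (L : Matrix (Fin n) (Fin n) ℝ → ℝ) (Zs : Matrix (Fin n) (Fin r) ℝ)
        (α β ε φ : ℝ) (Z : ℕ → Matrix (Fin n) (Fin r) ℝ),
        0 < r → Zs.rank = r → 0 < ε →
        SmoothOnRegion L (regionTwo Zs ε) →
        gradAt L Zs = 0 →
        LocalRIP L (regionTwo Zs ε) α β →
        LocalGradLipschitz L (regionTwo Zs ε) L₂ →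
        IsGradientDescent L (stepSize Zs α β) Z →
        distTwo (Z 0) Zs ≤ φ * ‖Zs‖ →
        φ ≤ min (ε / 2) (c₀ * (α / (condNumber Zs * √(r : ℝ)))) →
        ∀ t : ℕ, distTwo (Z t) Zs ≤ rate Zs α β ^ t * φ * ‖Zs‖) ∧
    -- `ℓ_∞`-error contraction
    (∀ L₂ Linf εmax : ℝ, ∃ c₀ : ℝ, 0 < c₀ ∧
      ∀ (n r : ℕ) (L : Matrix (Fin n) (Fin n) ℝ → ℝ) (Zs : Matrix (Fin n) (Fin r) ℝ)
        (α β ε φ ψ : ℝ) (Z : ℕ → Matrix (Fin n) (Fin r) ℝ),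
        0 < r → Zs.rank = r → 0 < ε → ε ≤ εmax →
        SmoothOnRegion L (regionInf Zs ε) →
        (∀ Y ∈ regionInf Zs ε, (gradAt L Y)ᵀ = gradAt L Y) →
        gradAt L Zs = 0 →
        LocalRIP L (regionInf Zs ε) α β →
        LocalGradLipschitz L (regionInf Zs ε) L₂ →
        RowHessianBound L (regionInf Zs ε) β →
        RowGradLipschitz L (regionInf Zs ε) Linf →
        IsGradientDescent L (stepSize Zs α β) Z →
        distTwo (Z 0) Zs ≤ φ * ‖Zs‖ →
        φ ≤ min (ε / 2) (c₀ * (α / (condNumber Zs * √(r : ℝ)))) →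
        distInf (Z 0) Zs ≤ ψ * twoInfNorm Zs →
        0 < ψ → ψ ≤ ε / 2 →
        β / α * condNumber Zs ^ (3 / 2 : ℝ) * √(r : ℝ) * (φ / ψ) ≤ c₀ →
        ∀ t : ℕ, distTwo (Z t) Zs ≤ rate Zs α β ^ t * φ * ‖Zs‖ ∧
          distInf (Z t) Zs ≤ rate Zs α β ^ t * ψ * twoInfNorm Zs) := by
  -- The maxima allow arbitrary real `L₂`, `Linf`, `εmax`. In the second constant each of the three
  -- factors is at least `1`, so their product dominates every factor separately.
  refine ⟨fun L₂ => ⟨(1000 * max 1 L₂)⁻¹, by positivity, ?_⟩, fun L₂ Linf εmax =>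
    ⟨(1000 * (max 1 L₂ * (1 + max 0 Linf) * (1 + max 0 εmax)))⁻¹, by positivity, ?_⟩⟩
  · intro n r L Zs α β ε φ Z hr hrank hε hsm h0 hrip hlip hgd hinit hφ t
    have h1 : 1 ≤ max 1 L₂ := le_max_left _ _
    refine distTwo_contraction h1 (le_max_right _ _) (le_of_eq ?_) hr hrank hε hsm h0 hrip hlip
      hgd hinit hφ t
    field_simp
  · intro n r L Zs α β ε φ ψ Z hr hrank hε hεmax hsm hsymm h0 hrip hlip hrow hlipi hgd hinit hφ
      hiniti hψ hψε hφψ t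
    have h1 : 1 ≤ max 1 L₂ := le_max_left _ _
    have h2 : 0 ≤ max 0 Linf := le_max_left _ _
    have h3 : 0 ≤ max 0 εmax := le_max_left _ _
    refine distInf_contraction h1 (le_max_right _ _) h2 (le_max_right _ _) h3 (by positivity)
      ?_ ?_ ?_ hr hrank hε (hεmax.trans (le_max_right _ _)) hsm hsymm h0 hrip hlip hrow hlipi hgd
      hinit hφ hiniti hψ hψε hφψ t
    all_goals
      rw [inv_mul_eq_div, mul_div_assoc', div_le_one (by positivity)]
      gcongr
    · rw [mul_assoc]
      exact le_mul_of_one_le_right (by positivity) (one_le_mul_of_one_le_of_one_le (by linarith)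
        (by linarith))
    · calc max 0 Linf ≤ 1 * (1 + max 0 Linf) * 1 := by linarith
        _ ≤ _ := by gcongr; linarith
    · calc 1 + max 0 εmax = 1 * 1 * (1 + max 0 εmax) := by ring
        _ ≤ _ := by gcongr; linarith
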